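/- **Theorem 1.1.** Consider the Cauchy problem for the two-dimensional rotating shallow water system $$ h_t+(hu)_x+(hv)_y=0,\qquad u_t+uu_x+vu_y-v=-h_x,\qquad v_t+uv_x+vv_y+u=-h_y $$ on $\mathbb R^2$ with initial data $(h,u,v)|_{t=0}=(h_0,u_0,v_0)$, where $h_0\ge 0$. Suppose there are constants $\bar h$ and $R\ge 0$ such that $(h_0-\bar h,u_0,v_0)$ is supported in $B_R=\{(x,y):x^2+y^2\le R^2\}$ (so that $\bar h\ge 0$). Put $$ P_1(0)=\int_{\mathbb R^2}(h_0u_0x+h_0v_0y)\,dx\,dy,\qquad P_2(0)=\int_{\mathbb R^2}(h_0v_0x-h_0u_0y)\,dx\,dy, $$ $$ E(0)=\int_{\mathbb R^2}\bigl(h_0(u_0^2+v_0^2)+h_0^2-\bar h^2\bigr)\,dx\,dy,\qquad m(0)=\int_{\mathbb R^2}(h_0-\bar h)\,dx\,dy . $$ If $m(0)>0$ and $$ P_1(0)^2+\bigl(E(0)+P_2(0)\bigr)^2\ \ge\ \pi\bigl(R+2\pi\sqrt{\bar h}\bigr)^4E(0)\,\|h_0\|_{L^\infty}, $$ then classical solutions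 with these data lose $C^1$ regularity before time $2\pi$: there is a time $T_{\max}<2\pi$, depending only on the data, $\bar h$ and $R$, such that whenever a classical solution $(h,u,v)$ with these initial data (that is, $h,u,v$ are $C^1$ on $[0,T)\times\mathbb R^2$ and satisfy the system) exists on $[0,T)\times\mathbb R^2$, one has $T\le T_{\max}$. -/

import Mathlib

open Set MeasureTheory

namespace RotatingShallowWater

/-- `(h, u, v)`, as functions of `(t, x, y)`, is a classical solution of the rotating shallow water
system on `[0, T) × ℝ²`: all three functions are `C¹` up to the initial time, and the equations hold
pointwise for `0 < t < T` (hence also at `t = 0`, by continuity of the first derivatives). -/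
structure IsClassicalSolution (T : ℝ) (h u v : ℝ → ℝ → ℝ → ℝ) : Prop where
  contDiffOn_h : ContDiffOn ℝ 1 (fun p : ℝ × ℝ × ℝ => h p.1 p.2.1 p.2.2) (Ico 0 T ×ˢ univ)
  contDiffOn_u : ContDiffOn ℝ 1 (fun p : ℝ × ℝ × ℝ => u p.1 p.2.1 p.2.2) (Ico 0 T ×ˢ univ)
  contDiffOn_v : ContDiffOn ℝ 1 (fun p : ℝ × ℝ × ℝ => v p.1 p.2.1 p.2.2) (Ico 0 T ×ˢ univ)
  /-- Conservation of mass: `h_t + (hu)_x + (hv)_y = 0`. -/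
  mass_eq : ∀ t ∈ Ioo 0 T, ∀ x y : ℝ,
    deriv (fun s => h s x y) t
      + deriv (fun ξ => h t ξ y * u t ξ y) x
      + deriv (fun η => h t x η * v t x η) y = 0
  /-- First momentum equation: `u_t + u u_x + v u_y - v = -h_x`. -/
  momentum_x : ∀ t ∈ Ioo 0 T, ∀ x y : ℝ,
    deriv (fun s => u s x y) t
      + u t x y * deriv (fun ξ => u t ξ y) x
      + v t x y * deriv (fun η => u t x η) y
      - v t x y = -deriv (fun ξ => h t ξ y) x
  /-- Second momentum equation: `v_t + u v_x + v v_y + u = -h_y`. -/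
  momentum_y : ∀ t ∈ Ioo 0 T, ∀ x y : ℝ,
    deriv (fun s => v s x y) t
      + u t x y * deriv (fun ξ => v t ξ y) x
      + v t x y * deriv (fun η => v t x η) y
      + u t x y = -deriv (fun η => h t x η) y

/-- The disc `B_R = {(x, y) : x² + y² ≤ R²}`. -/
def disc (R : ℝ) : Set (ℝ × ℝ) := {p | p.1 ^ 2 + p.2 ^ 2 ≤ R ^ 2}

/-- Radial moment `P₁ = ∫ (h u x + h v y) dx dy` of a state `(h, u, v)` at a fixed time. -/
noncomputable def radialMoment (h u v : ℝ → ℝ → ℝ) : ℝ :=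
  ∫ p : ℝ × ℝ, (h p.1 p.2 * u p.1 p.2 * p.1 + h p.1 p.2 * v p.1 p.2 * p.2)

/-- Angular moment `P₂ = ∫ (h v x - h u y) dx dy` of a state `(h, u, v)` at a fixed time. -/
noncomputable def angularMoment (h u v : ℝ → ℝ → ℝ) : ℝ :=
  ∫ p : ℝ × ℝ, (h p.1 p.2 * v p.1 p.2 * p.1 - h p.1 p.2 * u p.1 p.2 * p.2)

/-- Energy `E = ∫ (h (u² + v²) + h² - h̄²) dx dy` relative to the background height `hbar`. -/
noncomputable def energy (hbar : ℝ) (h u v : ℝ → ℝ → ℝ) : ℝ :=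
  ∫ p : ℝ × ℝ,
    (h p.1 p.2 * (u p.1 p.2 ^ 2 + v p.1 p.2 ^ 2) + h p.1 p.2 ^ 2 - hbar ^ 2)

/-- Excess mass `m = ∫ (h - h̄) dx dy` relative to the background height `hbar`. -/
noncomputable def excessMass (hbar : ℝ) (h : ℝ → ℝ → ℝ) : ℝ :=
  ∫ p : ℝ × ℝ, (h p.1 p.2 - hbar)

/-- The norm `‖f‖_{L^∞(ℝ²)}` (Lebesgue essential supremum of `|f|`). -/
noncomputable def supNorm (f : ℝ → ℝ → ℝ) : ℝ :=
  (eLpNorm (fun p : ℝ × ℝ => f p.1 p.2) ⊤ volume).toReal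

end RotatingShallowWater

/-! Write `P₁`, `P₂` for the radial and angular moments and `E` for the energy. As long as the
perturbation of the rest state has compact support, `E` and the excess mass are conserved, `P₁' = E
+ P₂` and `P₂' = -P₁`. Hence `(P₁, E + P₂)` rotates with unit angular speed, and at some time `t ≤
π`, determined by the data alone, `P₁(t)²` equals `P₁(0)² + (E + P₂(0))²`. This `t` serves as
`Tmax`.

A solution living beyond `t` is contradictory. With `r = R + 2π√hbar`, Cauchy–Schwarz on the disc of
radius `r` gives `P₁(t)² ≤ K · r² · M`, where `K` is the integral of `h(u² + v²)` and `M` the mass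
in the disc (`radialMoment_sq_le`). Conservation of mass gives `M ≤ π r² ‖h₀‖`, and positive excess
mass gives `K < E` strictly (`kineticEnergy_lt_energy`). So `P₁(t)² < π r⁴ E ‖h₀‖`, against the
assumption on the data.

The analytic input is that the perturbation stays in that disc (`eq_rest_of_lt`) and that `h` stays
nonnegative (`height_nonneg`). Finite propagation speed uses backward cones of slope slightly above
`√hbar`: a weighted energy if `hbar > 0`, transport estimates in the vacuum case `hbar = 0` where
that energy degenerates, and a continuity argument (`cone_bootstrap`) that removes the a priori
bound on the wave speeds. -/

namespace RotatingShallowWater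

/-! ### Calculus on the space-time strip -/

/-- `A`, as a function of `(t, x, y)`, is `C¹` on `[0, T) × ℝ²`. -/
def StripC1 (T : ℝ) (A : ℝ → ℝ → ℝ → ℝ) : Prop :=
  ContDiffOn ℝ 1 (fun p : ℝ × ℝ × ℝ => A p.1 p.2.1 p.2.2) (Ico 0 T ×ˢ univ)

theorem StripC1.continuousOn {T : ℝ} {A : ℝ → ℝ → ℝ → ℝ} (hA : StripC1 T A) :
    ContinuousOn (fun p : ℝ × ℝ × ℝ => A p.1 p.2.1 p.2.2) (Ico 0 T ×ˢ univ) :=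
  ContDiffOn.continuousOn hA

theorem StripC1.contDiffOn_interior {T : ℝ} {A : ℝ → ℝ → ℝ → ℝ} (hA : StripC1 T A) :
    ContDiffOn ℝ 1 (fun p : ℝ × ℝ × ℝ => A p.1 p.2.1 p.2.2) (Ioo 0 T ×ˢ univ) :=
  ContDiffOn.mono hA (prod_mono Ioo_subset_Ico_self subset_rfl)

theorem isOpen_strip (T : ℝ) : IsOpen (Ioo 0 T ×ˢ (univ : Set (ℝ × ℝ))) :=
  isOpen_Ioo.prod isOpen_univ

theorem StripC1.contDiffAt {T : ℝ} {A : ℝ → ℝ → ℝ → ℝ} (hA : StripC1 T A) {t : ℝ}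
    (ht : t ∈ Ioo 0 T) (x y : ℝ) :
    ContDiffAt ℝ 1 (fun p : ℝ × ℝ × ℝ => A p.1 p.2.1 p.2.2) (t, x, y) :=
  hA.contDiffOn_interior.contDiffAt ((isOpen_strip T).mem_nhds ⟨ht, mem_univ _⟩)

theorem StripC1.hasFDerivAt {T : ℝ} {A : ℝ → ℝ → ℝ → ℝ} (hA : StripC1 T A) {t : ℝ}
    (ht : t ∈ Ioo 0 T) (x y : ℝ) :
    HasFDerivAt (fun p : ℝ × ℝ × ℝ => A p.1 p.2.1 p.2.2)
      (fderiv ℝ (fun p : ℝ × ℝ × ℝ => A p.1 p.2.1 p.2.2) (t, x, y)) (t, x, y) :=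
  ((hA.contDiffAt ht x y).differentiableAt one_ne_zero).hasFDerivAt

theorem StripC1.hasDerivAt_t {T : ℝ} {A : ℝ → ℝ → ℝ → ℝ} (hA : StripC1 T A) {t : ℝ}
    (ht : t ∈ Ioo 0 T) (x y : ℝ) :
    HasDerivAt (fun s => A s x y)
      (fderiv ℝ (fun p : ℝ × ℝ × ℝ => A p.1 p.2.1 p.2.2) (t, x, y) (1, 0, 0)) t :=
  HasFDerivAt.comp_hasDerivAt (f := fun s : ℝ => (s, x, y)) t (hA.hasFDerivAt ht x y)
    ((hasDerivAt_id t).prodMk ((hasDerivAt_const t x).prodMk (hasDerivAt_const t y)))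

theorem StripC1.hasDerivAt_x {T : ℝ} {A : ℝ → ℝ → ℝ → ℝ} (hA : StripC1 T A) {t : ℝ}
    (ht : t ∈ Ioo 0 T) (x y : ℝ) :
    HasDerivAt (fun ξ => A t ξ y)
      (fderiv ℝ (fun p : ℝ × ℝ × ℝ => A p.1 p.2.1 p.2.2) (t, x, y) (0, 1, 0)) x :=
  HasFDerivAt.comp_hasDerivAt (f := fun ξ : ℝ => (t, ξ, y)) x (hA.hasFDerivAt ht x y)
    ((hasDerivAt_const x t).prodMk ((hasDerivAt_id x).prodMk (hasDerivAt_const x y)))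

theorem StripC1.hasDerivAt_y {T : ℝ} {A : ℝ → ℝ → ℝ → ℝ} (hA : StripC1 T A) {t : ℝ}
    (ht : t ∈ Ioo 0 T) (x y : ℝ) :
    HasDerivAt (fun η => A t x η)
      (fderiv ℝ (fun p : ℝ × ℝ × ℝ => A p.1 p.2.1 p.2.2) (t, x, y) (0, 0, 1)) y :=
  HasFDerivAt.comp_hasDerivAt (f := fun η : ℝ => (t, x, η)) y (hA.hasFDerivAt ht x y)
    ((hasDerivAt_const y t).prodMk ((hasDerivAt_const y x).prodMk (hasDerivAt_id y)))

/-- Chain rule along a straight space-time line through `(t, x, y)`. -/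
theorem StripC1.hasDerivAt_line {T : ℝ} {A : ℝ → ℝ → ℝ → ℝ} (hA : StripC1 T A) {t : ℝ}
    (ht : t ∈ Ioo 0 T) (x y a b : ℝ) :
    HasDerivAt (fun s => A (t + s) (x + s * a) (y + s * b))
      (deriv (fun s => A s x y) t + a * deriv (fun ξ => A t ξ y) x
        + b * deriv (fun η => A t x η) y) 0 := by
  have hγ : HasDerivAt (fun s : ℝ => (t + s, x + s * a, y + s * b)) (1, a, b) 0 :=
    ((hasDerivAt_id (0 : ℝ)).const_add t).prodMk
      ((((hasDerivAt_id (0 : ℝ)).mul_const a).const_add x |>.congr_deriv (one_mul a)).prodMk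
        (((hasDerivAt_id (0 : ℝ)).mul_const b).const_add y |>.congr_deriv (one_mul b)))
  have h0 : (t, x, y) = (fun s : ℝ => (t + s, x + s * a, y + s * b)) 0 := by simp
  have hL := hA.hasFDerivAt ht x y
  have := HasFDerivAt.comp_hasDerivAt_of_eq (0 : ℝ) hL hγ h0
  refine this.congr_deriv ?_
  rw [(hA.hasDerivAt_t ht x y).deriv, (hA.hasDerivAt_x ht x y).deriv,
    (hA.hasDerivAt_y ht x y).deriv, ← smul_eq_mul, ← smul_eq_mul b, ← map_smul, ← map_smul,
    ← map_add, ← map_add]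
  simp

/-! ### Integrating balance laws over the plane -/

/-- The integral over the plane of a directional derivative of a compactly supported `C¹`
function vanishes. -/
theorem integral_fderiv_apply_eq_zero {f : ℝ × ℝ → ℝ} (hf : ContDiff ℝ 1 f)
    (hc : HasCompactSupport f) (w : ℝ × ℝ) : ∫ p, fderiv ℝ f p w = 0 := by
  have hint : Integrable (fun p => fderiv ℝ f p w) :=
    ((hf.continuous_fderiv one_ne_zero).clm_apply continuous_const).integrable_of_hasCompactSupport
      (hc.fderiv_apply ℝ w)
  -- Integration by parts against the constant function `1`.
  have := integral_mul_fderiv_eq_neg_fderiv_mul_of_integrable (μ := volume) (f := fun _ => (1 : ℝ))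
    (g := f) (v := w) (by simp) (by simpa using hint)
    (by simpa using hf.continuous.integrable_of_hasCompactSupport hc)
    (by simp) (fun p _ => (hf.differentiable one_ne_zero) p)
  simpa using this

theorem integral_divergence_eq_zero {F : ℝ → ℝ → ℝ} {K : Set (ℝ × ℝ)} (hK : IsCompact K)
    (hF : ContDiff ℝ 1 (fun p : ℝ × ℝ => F p.1 p.2))
    (hv : ∀ x y, (x, y) ∉ K → F x y = 0) :
    (Integrable (fun p : ℝ × ℝ => deriv (fun ξ => F ξ p.2) p.1) ∧
      ∫ p : ℝ × ℝ, deriv (fun ξ => F ξ p.2) p.1 = 0) ∧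
    (Integrable (fun p : ℝ × ℝ => deriv (fun η => F p.1 η) p.2) ∧
      ∫ p : ℝ × ℝ, deriv (fun η => F p.1 η) p.2 = 0) := by
  have hc : HasCompactSupport (fun p : ℝ × ℝ => F p.1 p.2) :=
    HasCompactSupport.intro hK fun p hp => hv p.1 p.2 hp
  have hint (w) : Integrable (fun p => fderiv ℝ (fun p : ℝ × ℝ => F p.1 p.2) p w) :=
    ((hF.continuous_fderiv one_ne_zero).clm_apply continuous_const).integrable_of_hasCompactSupport
      (hc.fderiv_apply ℝ w)
  have hD (p : ℝ × ℝ) := ((hF.differentiable one_ne_zero) p).hasFDerivAt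
  have h1 : (fun p : ℝ × ℝ => deriv (fun ξ => F ξ p.2) p.1)
      = fun p => fderiv ℝ (fun p : ℝ × ℝ => F p.1 p.2) p (1, 0) := by
    funext p
    exact (HasFDerivAt.comp_hasDerivAt (f := fun ξ : ℝ => (ξ, p.2)) p.1 (hD p)
      ((hasDerivAt_id p.1).prodMk (hasDerivAt_const p.1 p.2))).deriv
  have h2 : (fun p : ℝ × ℝ => deriv (fun η => F p.1 η) p.2)
      = fun p => fderiv ℝ (fun p : ℝ × ℝ => F p.1 p.2) p (0, 1) := by
    funext p
    exact (HasFDerivAt.comp_hasDerivAt (f := fun η : ℝ => (p.1, η)) p.2 (hD p)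
      ((hasDerivAt_const p.2 p.1).prodMk (hasDerivAt_id p.2))).deriv
  rw [h1, h2]
  exact ⟨⟨hint _, integral_fderiv_apply_eq_zero hF hc _⟩,
    ⟨hint _, integral_fderiv_apply_eq_zero hF hc _⟩⟩

theorem StripC1.contDiff_slice {T : ℝ} {A : ℝ → ℝ → ℝ → ℝ} (hA : StripC1 T A) {t : ℝ}
    (ht : t ∈ Ico 0 T) : ContDiff ℝ 1 (fun p : ℝ × ℝ => A t p.1 p.2) := by
  rw [← contDiffOn_univ]
  exact ContDiffOn.comp (g := fun p : ℝ × ℝ × ℝ => A p.1 p.2.1 p.2.2) hA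
    (f := fun p : ℝ × ℝ => (t, p)) (by fun_prop) fun p _ => ⟨ht, mem_univ _⟩

theorem StripC1.continuousOn_integral {T s : ℝ} {A : ℝ → ℝ → ℝ → ℝ} (hA : StripC1 T A)
    (hs : s ≤ T) {K : Set (ℝ × ℝ)} (hK : IsCompact K)
    (hv : ∀ t ∈ Ico 0 s, ∀ x y, (x, y) ∉ K → A t x y = 0) :
    ContinuousOn (fun t => ∫ p : ℝ × ℝ, A t p.1 p.2) (Ico 0 s) :=
  continuousOn_integral_of_compact_support (f := fun t (p : ℝ × ℝ) => A t p.1 p.2) hK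
    (hA.continuousOn.mono (prod_mono (Ico_subset_Ico_right hs) subset_rfl))
    fun t p ht hp => hv t ht p.1 p.2 hp

/-- Integrated form of a balance law `A_t + F_x + G_y = S` with compactly supported densities. -/
theorem hasDerivAt_integral_of_balance {T s : ℝ} {A F G : ℝ → ℝ → ℝ → ℝ} {S : ℝ → ℝ → ℝ}
    (hA : StripC1 T A) (hF : StripC1 T F) (hG : StripC1 T G) (hs : s ≤ T)
    {K : Set (ℝ × ℝ)} (hK : IsCompact K)
    (hAv : ∀ t ∈ Ico 0 s, ∀ x y, (x, y) ∉ K → A t x y = 0)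
    (hFv : ∀ t ∈ Ico 0 s, ∀ x y, (x, y) ∉ K → F t x y = 0)
    (hGv : ∀ t ∈ Ico 0 s, ∀ x y, (x, y) ∉ K → G t x y = 0)
    {t : ℝ} (ht : t ∈ Ioo 0 s)
    (hbal : ∀ x y, ∃ a f g, HasDerivAt (fun τ => A τ x y) a t ∧ HasDerivAt (fun ξ => F t ξ y) f x ∧
      HasDerivAt (fun η => G t x η) g y ∧ a + f + g = S x y) :
    HasDerivAt (fun τ => ∫ p : ℝ × ℝ, A τ p.1 p.2) (∫ p : ℝ × ℝ, S p.1 p.2) t := by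
  have htT : t ∈ Ico 0 T := ⟨ht.1.le, ht.2.trans_le hs⟩
  obtain ⟨⟨hFi, hF0⟩, -⟩ := integral_divergence_eq_zero hK (hF.contDiff_slice htT)
    (hFv t ⟨ht.1.le, ht.2⟩)
  obtain ⟨-, ⟨hGi, hG0⟩⟩ := integral_divergence_eq_zero hK (hG.contDiff_slice htT)
    (hGv t ⟨ht.1.le, ht.2⟩)
  set DA : ℝ → ℝ × ℝ → ℝ := fun τ p =>
    fderiv ℝ (fun p : ℝ × ℝ × ℝ => A p.1 p.2.1 p.2.2) (τ, p) (1, 0, 0) with hDA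
  have hDAc : ContinuousOn (fun q : ℝ × ℝ × ℝ => DA q.1 q.2) (Ioo 0 T ×ˢ univ) :=
    (hA.contDiffOn_interior.continuousOn_fderiv_of_isOpen (isOpen_strip T) le_rfl).clm_apply
      continuousOn_const
  have hIoo : Ioo 0 s ⊆ Ioo 0 T := Ioo_subset_Ioo_right hs
  have hder (τ) (hτ : τ ∈ Ioo 0 s) (p : ℝ × ℝ) : HasDerivAt (fun τ => A τ p.1 p.2) (DA τ p) τ :=
    hA.hasDerivAt_t (hIoo hτ) p.1 p.2
  -- Off `K` the density vanishes for all nearby times, so its time derivative does too; this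
  -- supports the dominating function on `K`.
  have hDAv (τ) (hτ : τ ∈ Ioo 0 s) (p : ℝ × ℝ) (hp : p ∉ K) : DA τ p = 0 := by
    refine (hder τ hτ p).unique ((hasDerivAt_const τ (0 : ℝ)).congr_of_eventuallyEq ?_)
    filter_upwards [isOpen_Ioo.mem_nhds hτ] with σ hσ
    exact hAv σ ⟨hσ.1.le, hσ.2⟩ p.1 p.2 hp
  have hJ : Icc (t / 2) ((t + s) / 2) ⊆ Ioo 0 s := fun τ hτ =>
    ⟨by linarith [hτ.1, ht.1], by linarith [hτ.2, ht.2]⟩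
  obtain ⟨C, hC⟩ := (isCompact_Icc (a := t / 2) (b := (t + s) / 2)).prod hK
    |>.exists_bound_of_continuousOn
      (hDAc.mono (prod_mono (hJ.trans hIoo) (subset_univ K)))
  have hnhds : Icc (t / 2) ((t + s) / 2) ∈ nhds t :=
    Icc_mem_nhds (by linarith [ht.1]) (by linarith [ht.2])
  have hslice (τ) (hτ : τ ∈ Ico 0 s) : Integrable (fun p : ℝ × ℝ => A τ p.1 p.2) :=
    (hA.contDiff_slice (Ico_subset_Ico_right hs hτ)).continuous.integrable_of_hasCompactSupport
      (HasCompactSupport.intro hK fun p hp => hAv τ hτ p.1 p.2 hp)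
  have hDAt : Continuous (DA t) := by
    rw [← continuousOn_univ]
    exact ContinuousOn.comp (f := fun p : ℝ × ℝ => (t, p)) hDAc (by fun_prop)
      fun p _ => ⟨hIoo ht, mem_univ _⟩
  obtain ⟨hDAi, hmain⟩ := hasDerivAt_integral_of_dominated_loc_of_deriv_le (μ := volume)
    (F := fun τ (p : ℝ × ℝ) => A τ p.1 p.2) (F' := DA) (bound := K.indicator fun _ => C) hnhds
    (by
      filter_upwards [hnhds] with τ hτ
      exact (hslice τ ⟨(hJ hτ).1.le, (hJ hτ).2⟩).aestronglyMeasurable)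
    (hslice t ⟨ht.1.le, ht.2⟩) hDAt.aestronglyMeasurable
    (Filter.Eventually.of_forall fun p τ hτ => by
      by_cases hp : p ∈ K
      · rw [indicator_of_mem hp]; exact hC (τ, p) ⟨hτ, hp⟩
      · rw [indicator_of_notMem hp, hDAv τ (hJ hτ) p hp, norm_zero])
    ((integrable_indicator_iff hK.measurableSet).2 (integrableOn_const hK.measure_ne_top))
    (Filter.Eventually.of_forall fun p τ hτ => hder τ (hJ hτ) p)
  refine hmain.congr_deriv ?_
  have hS : (fun p : ℝ × ℝ => S p.1 p.2) = fun p => (DA t p + deriv (fun ξ => F t ξ p.2) p.1)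
      + deriv (fun η => G t p.1 η) p.2 := by
    funext p
    obtain ⟨a, f, g, ha, hf, hg, h⟩ := hbal p.1 p.2
    rw [← h, (hder t ht p).unique ha, hf.deriv, hg.deriv]
  have h1 : ∫ p, (DA t p + deriv (fun ξ => F t ξ p.2) p.1) = ∫ p, DA t p := by
    rw [integral_add hDAi hFi, hF0, add_zero]
  rw [hS, ← h1, ← add_zero (∫ p, (DA t p + deriv (fun ξ => F t ξ p.2) p.1)), ← hG0]
  exact (integral_add (hDAi.add hFi) hGi).symm

/-! ### Derivative bounds and the maximum principle for transport -/

/-- The within-derivative is continuous up to `t = 0`, so compactness bounds it on `[0, s] × K`; for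
`t > 0` it agrees with the ordinary derivative. -/
theorem StripC1.exists_deriv_bound {T s : ℝ} {A : ℝ → ℝ → ℝ → ℝ} (hA : StripC1 T A) (hs : s < T)
    {K : Set (ℝ × ℝ)} (hK : IsCompact K) :
    ∃ C, ∀ t ∈ Ioc 0 s, ∀ x y, (x, y) ∈ K →
      |deriv (fun ξ => A t ξ y) x| ≤ C ∧ |deriv (fun η => A t x η) y| ≤ C := by
  have hU : UniqueDiffOn ℝ (Ico 0 T ×ˢ (univ : Set (ℝ × ℝ))) :=
    (uniqueDiffOn_Ico 0 T).prod uniqueDiffOn_univ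
  have hc := ContDiffOn.continuousOn_fderivWithin hA hU le_rfl
  have hsub : Icc 0 s ×ˢ K ⊆ Ico 0 T ×ˢ (univ : Set (ℝ × ℝ)) :=
    prod_mono (Icc_subset_Ico_right hs) (subset_univ K)
  obtain ⟨C₁, hC₁⟩ := (isCompact_Icc.prod hK).exists_bound_of_continuousOn
    ((hc.mono hsub).clm_apply (continuousOn_const (c := ((0, 1, 0) : ℝ × ℝ × ℝ))))
  obtain ⟨C₂, hC₂⟩ := (isCompact_Icc.prod hK).exists_bound_of_continuousOn
    ((hc.mono hsub).clm_apply (continuousOn_const (c := ((0, 0, 1) : ℝ × ℝ × ℝ))))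
  refine ⟨max C₁ C₂, fun t ht x y hxy => ?_⟩
  have htT : t ∈ Ioo 0 T := ⟨ht.1, ht.2.trans_lt hs⟩
  have hmem : (t, x, y) ∈ Icc 0 s ×ˢ K := ⟨⟨ht.1.le, ht.2⟩, hxy⟩
  have heq : fderivWithin ℝ (fun p : ℝ × ℝ × ℝ => A p.1 p.2.1 p.2.2) (Ico 0 T ×ˢ univ) (t, x, y)
      = fderiv ℝ (fun p : ℝ × ℝ × ℝ => A p.1 p.2.1 p.2.2) (t, x, y) :=
    fderivWithin_of_mem_nhds (Filter.mem_of_superset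
      ((isOpen_strip T).mem_nhds ⟨htT, mem_univ _⟩)
      (prod_mono Ioo_subset_Ico_self subset_rfl))
  have h₁ := hC₁ _ hmem
  have h₂ := hC₂ _ hmem
  rw [heq] at h₁ h₂
  rw [(hA.hasDerivAt_x htT x y).deriv, (hA.hasDerivAt_y htT x y).deriv]
  exact ⟨h₁.trans (le_max_left _ _), h₂.trans (le_max_right _ _)⟩

/-- Maximum principle for the transport operator `∂_t + a ∂_x + b ∂_y` on a compact region which
is not left backwards in time along the direction `(1, a, b)`. -/
theorem transport_max_principle {T s C : ℝ} {f a b : ℝ → ℝ → ℝ → ℝ} (hf : StripC1 T f)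
    (hs : s < T) {K : Set (ℝ × ℝ × ℝ)} (hK : IsCompact K) (hKs : ∀ p ∈ K, p.1 ∈ Icc 0 s)
    (hinit : ∀ x y, (0, x, y) ∈ K → f 0 x y ≤ 0)
    (hback : ∀ t x y, (t, x, y) ∈ K → 0 < t →
      ∀ᶠ r in nhdsWithin (0 : ℝ) (Iio 0), (t + r, x + r * a t x y, y + r * b t x y) ∈ K)
    (hd : ∀ t x y, (t, x, y) ∈ K → 0 < t → 0 < f t x y →
      deriv (fun τ => f τ x y) t + a t x y * deriv (fun ξ => f t ξ y) x
        + b t x y * deriv (fun η => f t x η) y ≤ C * f t x y) :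
    ∀ t x y, (t, x, y) ∈ K → f t x y ≤ 0 := by
  intro t₁ x₁ y₁ h₁
  by_contra! hpos
  -- Maximise `exp(-(C+1)t) f`. The rate `C + 1`, rather than `C`, makes its derivative along `(1,
  -- a, b)` strictly negative at a positive maximum.
  have hcont : ContinuousOn (fun p : ℝ × ℝ × ℝ => Real.exp (-(C + 1) * p.1) * f p.1 p.2.1 p.2.2) K :=
    (by fun_prop : Continuous fun p : ℝ × ℝ × ℝ => Real.exp (-(C + 1) * p.1)).continuousOn.mul
      (hf.continuousOn.mono fun p hp => ⟨⟨(hKs p hp).1, (hKs p hp).2.trans_lt hs⟩, mem_univ _⟩)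
  obtain ⟨⟨t, x, y⟩, hp, hmax⟩ := hK.exists_isMaxOn ⟨_, h₁⟩ hcont
  have hfp : 0 < f t x y := by
    have := hmax h₁
    simp only [mem_ofPred_eq] at this
    exact (mul_pos_iff_of_pos_left (Real.exp_pos _)).1
      ((mul_pos (Real.exp_pos _) hpos).trans_le this)
  have ht0 : 0 < t := by
    rcases (hKs _ hp).1.lt_or_eq with h | h
    · exact h
    · obtain rfl : 0 = t := h
      exact absurd (hinit x y hp) hfp.not_ge
  have htT : t ∈ Ioo 0 T := ⟨ht0, (hKs _ hp).2.trans_lt hs⟩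
  have hline := hf.hasDerivAt_line htT x y (a t x y) (b t x y)
  have hexp : HasDerivAt (fun r : ℝ => Real.exp (-(C + 1) * (t + r)))
      (Real.exp (-(C + 1) * t) * (-(C + 1))) 0 := by
    have := (((hasDerivAt_id (0 : ℝ)).const_add t).const_mul (-(C + 1))).exp
    simpa using this
  have hprod := hexp.mul hline
  simp only [zero_mul, add_zero] at hprod
  have hle := hd t x y hp ht0 hfp
  have hneg : Real.exp (-(C + 1) * t) * (-(C + 1)) * f t x y + Real.exp (-(C + 1) * t) *
      (deriv (fun τ => f τ x y) t + a t x y * deriv (fun ξ => f t ξ y) x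
        + b t x y * deriv (fun η => f t x η) y) < 0 := by
    have he := Real.exp_pos (-(C + 1) * t)
    nlinarith [mul_le_mul_of_nonneg_left hle he.le, mul_pos he hfp]
  -- Only left difference quotients are used: backward points stay in `K`, where the weighted
  -- function is no larger, so these quotients are nonnegative.
  have hsub : Iio (0 : ℝ) ⊆ {0}ᶜ := fun r hr => ne_of_lt hr
  have hslope := hprod.tendsto_slope.mono_left (nhdsWithin_mono (0 : ℝ) hsub)
  have hge := ge_of_tendsto hslope (b := 0) ?_
  · exact absurd hneg hge.not_gt
  filter_upwards [hback t x y hp ht0, self_mem_nhdsWithin] with r hr hr0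
  have := hmax hr
  simp only [mem_ofPred_eq] at this
  rw [slope_def_field]
  refine div_nonneg_of_nonpos ?_ (by simpa using (mem_Iio.1 hr0).le)
  simpa using this

/-! ### Smoothed backward cones -/

/-- The smooth approximation `(δ² + x² + y²)^{1/2}` of the Euclidean norm. -/
noncomputable def smoothNorm (δ x y : ℝ) : ℝ := √(δ ^ 2 + x ^ 2 + y ^ 2)

theorem smoothNorm_pos {δ : ℝ} (hδ : 0 < δ) (x y : ℝ) : 0 < smoothNorm δ x y :=
  Real.sqrt_pos.2 (by positivity)

theorem smoothNorm_sq (δ x y : ℝ) : smoothNorm δ x y ^ 2 = δ ^ 2 + x ^ 2 + y ^ 2 :=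
  Real.sq_sqrt (by positivity)

/-- Minkowski's inequality for the vector `(δ, x, y)`, obtained from Cauchy–Schwarz in the plane. -/
theorem smoothNorm_add_le {δ c : ℝ} (hc : 0 ≤ c) (x y : ℝ) {a b : ℝ} (hab : a ^ 2 + b ^ 2 ≤ c ^ 2) {r : ℝ} :
    smoothNorm δ (x + r * a) (y + r * b) ≤ smoothNorm δ x y + |r| * c := by
  have hN : 0 ≤ smoothNorm δ x y := Real.sqrt_nonneg _
  refine Real.sqrt_le_iff.2 ⟨by positivity, ?_⟩
  have h1 : |x * a + y * b| ≤ smoothNorm δ x y * c := by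
    refine abs_le_of_sq_le_sq ?_ (mul_nonneg hN hc)
    rw [mul_pow, smoothNorm_sq]
    nlinarith [sq_nonneg (x * b - y * a), mul_le_mul_of_nonneg_left hab (by positivity : 0 ≤ x ^ 2 + y ^ 2),
      mul_nonneg (sq_nonneg δ) (sq_nonneg c)]
  have h2 : r * (x * a + y * b) ≤ |r| * (smoothNorm δ x y * c) :=
    (le_abs_self _).trans (by rw [abs_mul]; gcongr)
  have h3 : r ^ 2 * (a ^ 2 + b ^ 2) ≤ r ^ 2 * c ^ 2 := by gcongr
  nlinarith [smoothNorm_sq δ x y, sq_abs r]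

theorem contDiff_smoothNorm {δ : ℝ} (hδ : 0 < δ) :
    ContDiff ℝ 1 (fun p : ℝ × ℝ => smoothNorm δ p.1 p.2) :=
  ContDiff.sqrt (f := fun p : ℝ × ℝ => δ ^ 2 + p.1 ^ 2 + p.2 ^ 2) (by fun_prop)
    fun p => by positivity

theorem hasDerivAt_smoothNorm_left {δ : ℝ} (hδ : 0 < δ) (x y : ℝ) :
    HasDerivAt (fun ξ => smoothNorm δ ξ y) (x / smoothNorm δ x y) x := by
  have h := (((hasDerivAt_pow 2 x).const_add (δ ^ 2)).add_const (y ^ 2)).sqrt (by positivity)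
  refine h.congr_deriv ?_
  have := smoothNorm_pos hδ x y
  unfold smoothNorm at this ⊢
  field_simp
  norm_num

theorem hasDerivAt_smoothNorm_right {δ : ℝ} (hδ : 0 < δ) (x y : ℝ) :
    HasDerivAt (fun η => smoothNorm δ x η) (y / smoothNorm δ x y) y := by
  have h := ((hasDerivAt_pow 2 y).const_add (δ ^ 2 + x ^ 2)).sqrt (by positivity)
  refine h.congr_deriv ?_
  have := smoothNorm_pos hδ x y
  unfold smoothNorm at this ⊢
  field_simp
  norm_num

/-- Strictness comes from `δ > 0`; it later keeps a cone base off a closed disc tangent to the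
circle of radius `ρ`. -/
theorem sq_add_sq_lt_of_smoothNorm_le {δ ρ x y : ℝ} (hδ : 0 < δ) (h : smoothNorm δ x y ≤ ρ) :
    x ^ 2 + y ^ 2 < ρ ^ 2 := by
  have := smoothNorm_sq δ x y
  have := smoothNorm_pos hδ x y
  nlinarith

/-- A defining function of a smoothed backward cone of speed `c` with axis through `(a, b)`. -/
noncomputable def coneFn (ρ c δ a b t x y : ℝ) : ℝ := ρ - c * t - smoothNorm δ (x - a) (y - b)

theorem contDiff_coneFn {δ : ℝ} (hδ : 0 < δ) (ρ c a b : ℝ) :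
    ContDiff ℝ 1 (fun p : ℝ × ℝ × ℝ => coneFn ρ c δ a b p.1 p.2.1 p.2.2) := by
  unfold coneFn
  have := (contDiff_smoothNorm hδ).comp
    (by fun_prop : ContDiff ℝ 1 (fun p : ℝ × ℝ × ℝ => (p.2.1 - a, p.2.2 - b)))
  exact ContDiff.sub (by fun_prop) this

theorem hasDerivAt_coneFn {δ : ℝ} (hδ : 0 < δ) (ρ c a b t x y : ℝ) :
    HasDerivAt (fun τ => coneFn ρ c δ a b τ x y) (-c) t ∧
    HasDerivAt (fun ξ => coneFn ρ c δ a b t ξ y)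
      (-((x - a) / smoothNorm δ (x - a) (y - b))) x ∧
    HasDerivAt (fun η => coneFn ρ c δ a b t x η)
      (-((y - b) / smoothNorm δ (x - a) (y - b))) y := by
  refine ⟨?_, ?_, ?_⟩
  · have := (((hasDerivAt_id t).const_mul c).const_sub ρ).sub_const (smoothNorm δ (x - a) (y - b))
    exact this.congr_deriv (by ring)
  · exact ((hasDerivAt_smoothNorm_left hδ (x - a) (y - b)).comp_sub_const x a).const_sub _
  · exact ((hasDerivAt_smoothNorm_right hδ (x - a) (y - b)).comp_sub_const y b).const_sub _

/-- The base of the cone. -/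
def coneBase (ρ δ a b : ℝ) : Set (ℝ × ℝ) := {p | smoothNorm δ (p.1 - a) (p.2 - b) ≤ ρ}

theorem isCompact_coneBase {δ : ℝ} (hδ : 0 < δ) (ρ a b : ℝ) : IsCompact (coneBase ρ δ a b) := by
  refine (isCompact_Icc (a := a - ρ) (b := a + ρ)).prod (isCompact_Icc (a := b - ρ) (b := b + ρ))
    |>.of_isClosed_subset ?_ ?_
  · have : Continuous fun p : ℝ × ℝ => smoothNorm δ (p.1 - a) (p.2 - b) :=
      (contDiff_smoothNorm hδ).continuous.comp
        (by fun_prop : Continuous fun p : ℝ × ℝ => (p.1 - a, p.2 - b))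
    exact isClosed_le this continuous_const
  · intro p hp
    have hp' : smoothNorm δ (p.1 - a) (p.2 - b) ≤ ρ := hp
    have h1 := sq_add_sq_lt_of_smoothNorm_le hδ hp'
    have h0 := (smoothNorm_pos hδ _ _).le.trans hp'
    have hx : (p.1 - a) ^ 2 ≤ ρ ^ 2 := by nlinarith [sq_nonneg (p.2 - b)]
    have hy : (p.2 - b) ^ 2 ≤ ρ ^ 2 := by nlinarith [sq_nonneg (p.1 - a)]
    have hx' := abs_le_of_sq_le_sq' hx h0
    have hy' := abs_le_of_sq_le_sq' hy h0
    exact ⟨⟨by linarith [hx'.1], by linarith [hx'.2]⟩, ⟨by linarith [hy'.1], by linarith [hy'.2]⟩⟩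

theorem mem_coneBase {ρ c δ a b t x y : ℝ} (hc : 0 ≤ c) (ht : 0 ≤ t)
    (h : 0 ≤ coneFn ρ c δ a b t x y) : (x, y) ∈ coneBase ρ δ a b := by
  unfold coneFn at h
  change smoothNorm δ (x - a) (y - b) ≤ ρ
  nlinarith [mul_nonneg hc ht]

theorem isCompact_cone {δ c : ℝ} (hδ : 0 < δ) (hc : 0 ≤ c) (ρ a b s η : ℝ) (hη : 0 ≤ η) :
    IsCompact {p : ℝ × ℝ × ℝ | p.1 ∈ Icc 0 s ∧ η ≤ coneFn ρ c δ a b p.1 p.2.1 p.2.2} := by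
  refine (isCompact_Icc (a := 0) (b := s)).prod (isCompact_coneBase hδ ρ a b)
    |>.of_isClosed_subset ?_ fun p hp => ⟨hp.1, mem_coneBase hc hp.1.1 (hη.trans hp.2)⟩
  exact (isClosed_Icc.preimage continuous_fst).inter
    (isClosed_le continuous_const (contDiff_coneFn hδ ρ c a b).continuous)

/-- Backward rays of speed at most `c` stay in the cone. -/
theorem coneFn_le_of_backward {ρ c δ a b t x y α β r : ℝ} (hc : 0 ≤ c) (hr : r ≤ 0)
    (h : α ^ 2 + β ^ 2 ≤ c ^ 2) :
    coneFn ρ c δ a b t x y ≤ coneFn ρ c δ a b (t + r) (x + r * α) (y + r * β) := by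
  have := smoothNorm_add_le (δ := δ) hc (x - a) (y - b) h (r := r)
  rw [abs_of_nonpos hr] at this
  unfold coneFn
  rw [add_sub_right_comm x, add_sub_right_comm y]
  linarith

/-- Maximum principle for transport equations inside a cone. -/
theorem cone_max_principle {T s C ρ c δ a b η : ℝ} (hδ : 0 < δ) (hc : 0 ≤ c) (hη : 0 ≤ η)
    (hs : s < T) {f u v : ℝ → ℝ → ℝ → ℝ} (hf : StripC1 T f)
    (hspeed : ∀ t ∈ Icc 0 s, ∀ x y, η ≤ coneFn ρ c δ a b t x y →
      u t x y ^ 2 + v t x y ^ 2 ≤ c ^ 2)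
    (hinit : ∀ x y, η ≤ coneFn ρ c δ a b 0 x y → f 0 x y ≤ 0)
    (hd : ∀ t ∈ Ioc 0 s, ∀ x y, η ≤ coneFn ρ c δ a b t x y →
      deriv (fun τ => f τ x y) t + u t x y * deriv (fun ξ => f t ξ y) x
        + v t x y * deriv (fun η => f t x η) y ≤ C * f t x y) :
    ∀ t ∈ Icc 0 s, ∀ x y, η ≤ coneFn ρ c δ a b t x y → f t x y ≤ 0 := by
  intro t ht x y hq
  refine transport_max_principle (a := u) (b := v) (C := C) hf hs
    (isCompact_cone hδ hc ρ a b s η hη) (fun p hp => hp.1) (fun x y h => hinit x y h.2) ?_ ?_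
    t x y ⟨ht, hq⟩
  · rintro t x y ⟨ht, hq⟩ ht0
    have : Ioo (-t) 0 ∈ nhdsWithin (0 : ℝ) (Iio 0) := Ioo_mem_nhdsLT (by linarith)
    filter_upwards [this] with r hr
    have hr1 := hr.1
    have hr2 := hr.2
    have ht2 : t ≤ s := ht.2
    exact ⟨⟨by change 0 ≤ t + r; linarith, by change t + r ≤ s; linarith⟩,
      hq.trans (coneFn_le_of_backward hc hr2.le (hspeed t ht x y hq))⟩
  · rintro t x y ⟨ht, hq⟩ ht0 -
    exact hd t ⟨ht0, ht.2⟩ x y hq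

/-- Continuity argument in a cone: if smallness of the deviation from `w₀` up to time `s` forces the
state to equal `w₀` up to time `s`, then a state equal to `w₀` initially remains so. -/
theorem cone_bootstrap {T ρ c δ a b : ℝ} (hδ : 0 < δ) (hc : 0 < c) {w : ℝ × ℝ × ℝ → ℝ × ℝ × ℝ}
    {w₀ : ℝ × ℝ × ℝ} {G : Set (ℝ × ℝ × ℝ)} (hG : IsOpen G) (hw₀ : w₀ ∈ G)
    (hw : ContinuousOn w (Ico 0 T ×ˢ univ))
    (hinit : ∀ x y, 0 ≤ coneFn ρ c δ a b 0 x y → w (0, x, y) = w₀)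
    (hstep : ∀ s, 0 ≤ s → s < T →
      (∀ t ∈ Icc 0 s, ∀ x y, 0 ≤ coneFn ρ c δ a b t x y → w (t, x, y) ∈ G) →
      ∀ t ∈ Icc 0 s, ∀ x y, 0 < coneFn ρ c δ a b t x y → w (t, x, y) = w₀)
    {t x y : ℝ} (ht : t ∈ Ico 0 T) (hq : 0 < coneFn ρ c δ a b t x y) : w (t, x, y) = w₀ := by
  refine hstep t ht.1 ht.2 ?_ t ⟨ht.1, le_rfl⟩ x y hq
  by_contra! hbad
  obtain ⟨t', ht', x', y', hq', hw'⟩ := hbad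
  have hsub : {p : ℝ × ℝ × ℝ | p.1 ∈ Icc 0 t ∧ 0 ≤ coneFn ρ c δ a b p.1 p.2.1 p.2.2}
      ⊆ Ico 0 T ×ˢ univ := fun p hp => ⟨⟨hp.1.1, hp.1.2.trans_lt ht.2⟩, mem_univ _⟩
  have hcone := isCompact_cone hδ hc.le ρ a b t 0 le_rfl
  have hB := hcone.of_isClosed_subset
    ((hw.mono hsub).preimage_isClosed_of_isClosed hcone.isClosed hG.isClosed_compl) inter_subset_left
  -- A first bad time, which exists because the bad set is compact.
  obtain ⟨⟨t₁, x₁, y₁⟩, ⟨⟨ht₁, hq₁⟩, hw₁⟩, hmin⟩ := hB.exists_isMinOn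
    ⟨(t', x', y'), ⟨ht', hq'⟩, hw'⟩ continuousOn_fst
  have ht₁T : t₁ < T := ht₁.2.trans_lt ht.2
  have ht₁0 : 0 < t₁ := by
    rcases ht₁.1.lt_or_eq with h | h
    · exact h
    · obtain rfl : 0 = t₁ := h
      exact absurd (by rw [hinit x₁ y₁ hq₁]; exact hw₀) hw₁
  -- Since `c > 0`, going back in time at fixed position enters the open cone, where `hstep` already
  -- applies; the limit `r → t₁` then contradicts badness.
  have hbefore : ∀ r ∈ Ioo 0 t₁, w (r, x₁, y₁) = w₀ := by
    intro r hr
    refine hstep r hr.1.le (hr.2.trans ht₁T) (fun τ hτ x y hq => ?_) r ⟨hr.1.le, le_rfl⟩ x₁ y₁ ?_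
    · by_contra hn
      have := hmin ⟨⟨⟨hτ.1, hτ.2.trans (hr.2.le.trans ht₁.2)⟩, hq⟩, hn⟩
      have h1 : t₁ ≤ τ := this
      linarith [hτ.2, hr.2]
    · have h2 : 0 ≤ coneFn ρ c δ a b t₁ x₁ y₁ := hq₁
      unfold coneFn at h2 ⊢
      nlinarith [mul_lt_mul_of_pos_left hr.2 hc]
  have hlim : Filter.Tendsto (fun r => w (r, x₁, y₁)) (nhdsWithin t₁ (Iio t₁))
      (nhds (w (t₁, x₁, y₁))) := by
    refine (hw (t₁, x₁, y₁) ⟨⟨ht₁0.le, ht₁T⟩, mem_univ _⟩).tendsto.comp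
      (tendsto_nhdsWithin_of_tendsto_nhds_of_eventually_within _ ?_ ?_)
    · exact (by fun_prop : Continuous fun r : ℝ => (r, x₁, y₁)).continuousAt.mono_left
        nhdsWithin_le_nhds
    · filter_upwards [Ioo_mem_nhdsLT ht₁0] with r hr
      exact ⟨⟨hr.1.le, hr.2.trans ht₁T⟩, mem_univ _⟩
  have heq : w (t₁, x₁, y₁) = w₀ := by
    refine tendsto_nhds_unique hlim (tendsto_const_nhds.congr' ?_)
    filter_upwards [Ioo_mem_nhdsLT ht₁0] with r hr
    exact (hbefore r hr).symm
  exact hw₁ (by simpa only [heq] using hw₀)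

/-! ### Closure properties and the equations in non-conservative form -/

namespace StripC1
variable {T : ℝ} {A B : ℝ → ℝ → ℝ → ℝ}

theorem add (hA : StripC1 T A) (hB : StripC1 T B) : StripC1 T (fun t x y => A t x y + B t x y) :=
  ContDiffOn.add hA hB

theorem sub (hA : StripC1 T A) (hB : StripC1 T B) : StripC1 T (fun t x y => A t x y - B t x y) :=
  ContDiffOn.sub hA hB

theorem neg (hA : StripC1 T A) : StripC1 T (fun t x y => -A t x y) :=
  ContDiffOn.neg hA

theorem mul (hA : StripC1 T A) (hB : StripC1 T B) : StripC1 T (fun t x y => A t x y * B t x y) :=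
  ContDiffOn.mul hA hB

theorem pow (hA : StripC1 T A) (n : ℕ) : StripC1 T (fun t x y => A t x y ^ n) :=
  ContDiffOn.pow hA n

theorem const (T k : ℝ) : StripC1 T (fun _ _ _ => k) := contDiffOn_const

theorem coord_x (T : ℝ) : StripC1 T (fun _ x _ => x) :=
  (by fun_prop : ContDiff ℝ 1 fun p : ℝ × ℝ × ℝ => p.2.1).contDiffOn

theorem coord_y (T : ℝ) : StripC1 T (fun _ _ y => y) :=
  (by fun_prop : ContDiff ℝ 1 fun p : ℝ × ℝ × ℝ => p.2.2).contDiffOn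

end StripC1

/-- The first derivatives of a classical solution, with the equations in non-conservative form. -/
theorem IsClassicalSolution.exists_derivs {T : ℝ} {h u v : ℝ → ℝ → ℝ → ℝ}
    (sol : IsClassicalSolution T h u v) {t : ℝ} (ht : t ∈ Ioo 0 T) (x y : ℝ) :
    ∃ h_t h_x h_y u_t u_x u_y v_t v_x v_y : ℝ,
      (HasDerivAt (fun τ => h τ x y) h_t t ∧ HasDerivAt (fun ξ => h t ξ y) h_x x ∧
        HasDerivAt (fun η => h t x η) h_y y) ∧
      (HasDerivAt (fun τ => u τ x y) u_t t ∧ HasDerivAt (fun ξ => u t ξ y) u_x x ∧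
        HasDerivAt (fun η => u t x η) u_y y) ∧
      (HasDerivAt (fun τ => v τ x y) v_t t ∧ HasDerivAt (fun ξ => v t ξ y) v_x x ∧
        HasDerivAt (fun η => v t x η) v_y y) ∧
      h_t + (h_x * u t x y + h t x y * u_x) + (h_y * v t x y + h t x y * v_y) = 0 ∧
      u_t + u t x y * u_x + v t x y * u_y - v t x y = -h_x ∧
      v_t + u t x y * v_x + v t x y * v_y + u t x y = -h_y := by
  have hh : StripC1 T h := sol.contDiffOn_h
  have hu : StripC1 T u := sol.contDiffOn_u
  have hv : StripC1 T v := sol.contDiffOn_v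
  refine ⟨_, _, _, _, _, _, _, _, _,
    ⟨hh.hasDerivAt_t ht x y, hh.hasDerivAt_x ht x y, hh.hasDerivAt_y ht x y⟩,
    ⟨hu.hasDerivAt_t ht x y, hu.hasDerivAt_x ht x y, hu.hasDerivAt_y ht x y⟩,
    ⟨hv.hasDerivAt_t ht x y, hv.hasDerivAt_x ht x y, hv.hasDerivAt_y ht x y⟩, ?_, ?_, ?_⟩
  · have := sol.mass_eq t ht x y
    rwa [(hh.hasDerivAt_t ht x y).deriv,
      ((hh.hasDerivAt_x ht x y).fun_mul (hu.hasDerivAt_x ht x y)).deriv,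
      ((hh.hasDerivAt_y ht x y).fun_mul (hv.hasDerivAt_y ht x y)).deriv] at this
  · have := sol.momentum_x t ht x y
    rwa [(hu.hasDerivAt_t ht x y).deriv, (hu.hasDerivAt_x ht x y).deriv,
      (hu.hasDerivAt_y ht x y).deriv, (hh.hasDerivAt_x ht x y).deriv] at this
  · have := sol.momentum_y t ht x y
    rwa [(hv.hasDerivAt_t ht x y).deriv, (hv.hasDerivAt_x ht x y).deriv,
      (hv.hasDerivAt_y ht x y).deriv, (hh.hasDerivAt_y ht x y).deriv] at this

/-! ### Finite speed of propagation -/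

/-- A nonnegative continuous function with compact support and nonpositive integral vanishes. -/
theorem eq_zero_of_integral_nonpos {f : ℝ × ℝ → ℝ} (hf : Continuous f) {K : Set (ℝ × ℝ)}
    (hK : IsCompact K) (hv : ∀ p, p ∉ K → f p = 0) (h0 : ∀ p, 0 ≤ f p) (hi : ∫ p, f p ≤ 0)
    (p : ℝ × ℝ) : f p = 0 := by
  by_contra hp
  exact absurd (hf.integral_pos_of_hasCompactSupport_nonneg_nonzero (μ := volume)
    (HasCompactSupport.intro hK hv) h0 hp) hi.not_gt

/-- The energy flux through a surface moving at a speed exceeding the fastest wave speed. -/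
theorem energy_flux_le {c h k u v α β : ℝ} (hh : 0 ≤ h) (hc : √(u ^ 2 + v ^ 2) + √h ≤ c)
    (hαβ : α ^ 2 + β ^ 2 ≤ 1) :
    -(α * (u * (h * (u ^ 2 + v ^ 2) / 2 + h * k)) + β * (v * (h * (u ^ 2 + v ^ 2) / 2 + h * k)))
      ≤ c * ((h * (u ^ 2 + v ^ 2) + k ^ 2) / 2) := by
  set U := √(u ^ 2 + v ^ 2) with hU
  set S := √h with hS
  have hU2 : U ^ 2 = u ^ 2 + v ^ 2 := Real.sq_sqrt (by positivity)
  have hS2 : S ^ 2 = h := Real.sq_sqrt hh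
  have hU0 : 0 ≤ U := Real.sqrt_nonneg _
  have hS0 : 0 ≤ S := Real.sqrt_nonneg _
  rw [← hU2, ← hS2]
  have h1 : |α * u + β * v| ≤ U := by
    refine abs_le_of_sq_le_sq ?_ hU0
    rw [hU2]
    nlinarith [sq_nonneg (α * v - β * u),
      mul_le_mul_of_nonneg_right hαβ (by positivity : 0 ≤ u ^ 2 + v ^ 2)]
  have h2 : |S ^ 2 * U ^ 2 / 2 + S ^ 2 * k| ≤ S ^ 2 * U ^ 2 / 2 + S ^ 2 * |k| := by
    refine (abs_add_le _ _).trans (le_of_eq ?_)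
    rw [abs_of_nonneg (by positivity), abs_mul, abs_of_nonneg (sq_nonneg S)]
  have h3 : -((α * u + β * v) * (S ^ 2 * U ^ 2 / 2 + S ^ 2 * k))
      ≤ U * (S ^ 2 * U ^ 2 / 2 + S ^ 2 * |k|) := by
    refine (neg_le_abs _).trans ?_
    rw [abs_mul]
    gcongr
  -- Young's inequality, spending one factor `√h` as the sound speed; the other is absorbed into the
  -- kinetic term.
  have h4 : S * (S * U * |k|) ≤ S * ((S ^ 2 * U ^ 2 + k ^ 2) / 2) := by
    gcongr
    nlinarith [sq_nonneg (S * U - |k|), sq_abs k]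
  have h5 : (U + S) * ((S ^ 2 * U ^ 2 + k ^ 2) / 2) ≤ c * ((S ^ 2 * U ^ 2 + k ^ 2) / 2) := by
    gcongr
  nlinarith [mul_nonneg hU0 (sq_nonneg k)]

/-- Energy estimate in a cone: a solution at rest initially stays at rest as long as the
characteristic speeds do not exceed the slope of the cone. -/
theorem IsClassicalSolution.cone_energy {T s ρ c δ a b hbar : ℝ} {h u v : ℝ → ℝ → ℝ → ℝ}
    (sol : IsClassicalSolution T h u v) (hδ : 0 < δ) (hc : 0 ≤ c) (hs0 : 0 ≤ s) (hs : s < T)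
    (hgood : ∀ t ∈ Icc 0 s, ∀ x y, 0 ≤ coneFn ρ c δ a b t x y →
      0 < h t x y ∧ √(u t x y ^ 2 + v t x y ^ 2) + √(h t x y) ≤ c)
    (hinit : ∀ x y, 0 ≤ coneFn ρ c δ a b 0 x y → h 0 x y = hbar ∧ u 0 x y = 0 ∧ v 0 x y = 0)
    {t : ℝ} (ht : t ∈ Icc 0 s) {x y : ℝ} (hq : 0 < coneFn ρ c δ a b t x y) :
    h t x y = hbar ∧ u t x y = 0 ∧ v t x y = 0 := by
  have hh : StripC1 T h := sol.contDiffOn_h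
  have hu : StripC1 T u := sol.contDiffOn_u
  have hv : StripC1 T v := sol.contDiffOn_v
  -- A `C¹` monotone cut-off of the cone function, positive exactly inside the open cone.
  set φ : ℝ → ℝ → ℝ → ℝ := fun t x y => expNegInvGlue (coneFn ρ c δ a b t x y) with hφdef
  have hφ : StripC1 T φ :=
    ((expNegInvGlue.contDiff (n := 1)).comp (contDiff_coneFn hδ ρ c a b)).contDiffOn
  have hU : StripC1 T (fun t x y => h t x y * (u t x y ^ 2 + v t x y ^ 2)) :=
    hh.mul ((hu.pow 2).add (hv.pow 2))
  have hk : StripC1 T (fun t x y => h t x y - hbar) := hh.sub (.const T hbar)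
  -- Energy relative to the rest state: the equations give `e_t + (u g)_x + (v g)_y = 0`, the
  -- Coriolis terms cancelling.
  set e : ℝ → ℝ → ℝ → ℝ := fun t x y =>
    (h t x y * (u t x y ^ 2 + v t x y ^ 2) + (h t x y - hbar) ^ 2) / 2 with hedef
  set g : ℝ → ℝ → ℝ → ℝ := fun t x y =>
    h t x y * (u t x y ^ 2 + v t x y ^ 2) / 2 + h t x y * (h t x y - hbar) with hgdef
  have he : StripC1 T e := ((hU.add (hk.pow 2)).mul (.const T 2⁻¹))
  have hg : StripC1 T g := (hU.mul (.const T 2⁻¹)).add (hh.mul hk)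
  have hA := hφ.mul he
  have hF := hφ.mul (hu.mul hg)
  have hG := hφ.mul (hv.mul hg)
  have hK := isCompact_coneBase hδ ρ a b
  have hφ0 : ∀ t ∈ Ico 0 T, ∀ x y, (x, y) ∉ coneBase ρ δ a b → φ t x y = 0 := by
    intro t ht x y hxy
    refine expNegInvGlue.zero_of_nonpos ?_
    by_contra! hn
    exact hxy (mem_coneBase hc ht.1 hn.le)
  have hφe : ∀ t ∈ Icc 0 s, ∀ x y, 0 ≤ φ t x y * e t x y := by
    intro t ht x y
    rcases le_or_gt 0 (coneFn ρ c δ a b t x y) with hq | hq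
    · have := (hgood t ht x y hq).1
      exact mul_nonneg (expNegInvGlue.nonneg _) (by simp only [hedef]; positivity)
    · simp [hφdef, expNegInvGlue.zero_of_nonpos hq.le]
  have hcont := hA.continuousOn_integral le_rfl hK fun t ht x y hxy => by
    rw [hφ0 t ht x y hxy, zero_mul]
  have hder : ∀ τ ∈ Ioo 0 s, ∃ D ≤ 0,
      HasDerivAt (fun τ => ∫ p : ℝ × ℝ, φ τ p.1 p.2 * e τ p.1 p.2) D τ := by
    intro τ hτ
    have hτT : τ ∈ Ioo 0 T := ⟨hτ.1, hτ.2.trans hs⟩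
    have hψ (r : ℝ) : HasDerivAt expNegInvGlue (deriv expNegInvGlue r) r :=
      ((expNegInvGlue.contDiff (n := 1)).differentiable one_ne_zero r).hasDerivAt
    refine ⟨_, ?_, hasDerivAt_integral_of_balance hA hF hG le_rfl hK
      (fun t ht x y hxy => by rw [hφ0 t ht x y hxy, zero_mul])
      (fun t ht x y hxy => by rw [hφ0 t ht x y hxy, zero_mul])
      (fun t ht x y hxy => by rw [hφ0 t ht x y hxy, zero_mul])
      -- Only derivatives falling on the cut-off survive; their sign is that of the flux through the
      -- cone's lateral surface.
      (S := fun x y => deriv expNegInvGlue (coneFn ρ c δ a b τ x y) *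
        (-(c * e τ x y) + -((x - a) / smoothNorm δ (x - a) (y - b) * (u τ x y * g τ x y)
          + (y - b) / smoothNorm δ (x - a) (y - b) * (v τ x y * g τ x y)))) hτT ?_⟩
    · refine integral_nonpos fun p => ?_
      rcases le_or_gt 0 (coneFn ρ c δ a b τ p.1 p.2) with hq | hq
      · obtain ⟨hpos, hsp⟩ := hgood τ ⟨hτ.1.le, hτ.2.le⟩ p.1 p.2 hq
        have hN := smoothNorm_pos hδ (p.1 - a) (p.2 - b)
        have hN2 := smoothNorm_sq δ (p.1 - a) (p.2 - b)
        have := energy_flux_le (k := h τ p.1 p.2 - hbar) hpos.le hsp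
          (α := (p.1 - a) / smoothNorm δ (p.1 - a) (p.2 - b))
          (β := (p.2 - b) / smoothNorm δ (p.1 - a) (p.2 - b)) (by
            rw [div_pow, div_pow, ← add_div, div_le_one (by positivity), hN2]
            nlinarith [sq_nonneg δ])
        exact mul_nonpos_of_nonneg_of_nonpos expNegInvGlue.monotone.deriv_nonneg
          (by simp only [hedef, hgdef]; linarith)
      · have : deriv expNegInvGlue (coneFn ρ c δ a b τ p.1 p.2) = 0 := by
          refine ((hasDerivAt_const _ (0 : ℝ)).congr_of_eventuallyEq ?_).deriv
          filter_upwards [Iio_mem_nhds hq] with r hr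
          exact expNegInvGlue.zero_of_nonpos (le_of_lt hr)
        simp [this]
    · intro x y
      obtain ⟨h_t, h_x, h_y, u_t, u_x, u_y, v_t, v_x, v_y, ⟨Ht, Hx, Hy⟩, ⟨Ut, Ux, Uy⟩, ⟨Vt, Vx, Vy⟩,
        e₁, e₂, e₃⟩ := sol.exists_derivs hτT x y
      obtain ⟨qt, qx, qy⟩ := hasDerivAt_coneFn hδ ρ c a b τ x y
      have Φt := (hψ _).comp τ qt
      have Φx := (hψ _).comp x qx
      have Φy := (hψ _).comp y qy
      refine ⟨_, _, _,
        Φt.fun_mul (((Ht.fun_mul ((Ut.fun_pow 2).fun_add (Vt.fun_pow 2))).fun_add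
          ((Ht.sub_const hbar).fun_pow 2)).div_const 2),
        Φx.fun_mul (Ux.fun_mul (((Hx.fun_mul ((Ux.fun_pow 2).fun_add (Vx.fun_pow 2))).div_const
          2).fun_add (Hx.fun_mul (Hx.sub_const hbar)))),
        Φy.fun_mul (Vy.fun_mul (((Hy.fun_mul ((Uy.fun_pow 2).fun_add (Vy.fun_pow 2))).div_const
          2).fun_add (Hy.fun_mul (Hy.sub_const hbar)))), ?_⟩
      simp only [hedef, hgdef, Function.comp]
      generalize deriv expNegInvGlue (coneFn ρ c δ a b τ x y) = ψ'
      generalize expNegInvGlue (coneFn ρ c δ a b τ x y) = ψ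
      have e₁' : h_t = -((h_x * u τ x y + h τ x y * u_x) + (h_y * v τ x y + h τ x y * v_y)) := by
        linarith
      have e₂' : u_t = -h_x - u τ x y * u_x - v τ x y * u_y + v τ x y := by linarith
      have e₃' : v_t = -h_y - u τ x y * v_x - v τ x y * v_y - u τ x y := by linarith
      rw [e₁', e₂', e₃']
      ring
  have hanti : AntitoneOn (fun τ => ∫ p : ℝ × ℝ, φ τ p.1 p.2 * e τ p.1 p.2) (Icc 0 s) := by
    refine antitoneOn_of_deriv_nonpos (convex_Icc 0 s)
      (hcont.mono fun τ hτ => ⟨hτ.1, hτ.2.trans_lt hs⟩) ?_ ?_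
    · rw [interior_Icc]
      intro τ hτ
      obtain ⟨D, -, hD⟩ := hder τ hτ
      exact hD.differentiableAt.differentiableWithinAt
    · rw [interior_Icc]
      intro τ hτ
      obtain ⟨D, hD0, hD⟩ := hder τ hτ
      rwa [hD.deriv]
  have hzero : ∫ p : ℝ × ℝ, φ 0 p.1 p.2 * e 0 p.1 p.2 = 0 := by
    refine integral_eq_zero_of_ae (Filter.Eventually.of_forall fun p => ?_)
    rcases le_or_gt 0 (coneFn ρ c δ a b 0 p.1 p.2) with hq | hq
    · obtain ⟨h1, h2, h3⟩ := hinit p.1 p.2 hq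
      simp [hedef, h1, h2, h3]
    · simp [hφdef, expNegInvGlue.zero_of_nonpos hq.le]
  have htT : t ∈ Ico 0 T := ⟨ht.1, ht.2.trans_lt hs⟩
  have hle := hanti ⟨le_rfl, hs0⟩ ht ht.1
  simp only [hzero] at hle
  have hfin := eq_zero_of_integral_nonpos (hA.contDiff_slice htT).continuous hK
    (fun p hp => by rw [hφ0 t htT p.1 p.2 hp, zero_mul]) (fun p => hφe t ht p.1 p.2) hle (x, y)
  have hhpos := (hgood t ht x y hq.le).1
  have he0 : e t x y = 0 := by
    rcases mul_eq_zero.1 hfin with h0 | h0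
    · exact absurd h0 (expNegInvGlue.pos_of_pos hq).ne'
    · exact h0
  simp only [hedef] at he0
  have hk0 : (h t x y - hbar) ^ 2 = 0 := by
    nlinarith [sq_nonneg (h t x y - hbar),
      mul_nonneg hhpos.le (add_nonneg (sq_nonneg (u t x y)) (sq_nonneg (v t x y)))]
  have hU0 : u t x y ^ 2 + v t x y ^ 2 = 0 := by
    rw [hk0, add_zero] at he0
    have : h t x y * (u t x y ^ 2 + v t x y ^ 2) = 0 := by linarith
    exact (mul_eq_zero.1 this).resolve_left hhpos.ne'
  refine ⟨sub_eq_zero.1 (pow_eq_zero_iff two_ne_zero |>.1 hk0), ?_, ?_⟩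
  · exact pow_eq_zero_iff two_ne_zero |>.1 (by nlinarith [sq_nonneg (u t x y), sq_nonneg (v t x y)])
  · exact pow_eq_zero_iff two_ne_zero |>.1 (by nlinarith [sq_nonneg (u t x y), sq_nonneg (v t x y)])

/-- Vacuum version of `IsClassicalSolution.cone_energy`. -/
theorem IsClassicalSolution.cone_vacuum {T s ρ c δ a b : ℝ} {h u v : ℝ → ℝ → ℝ → ℝ}
    (sol : IsClassicalSolution T h u v) (hδ : 0 < δ) (hc : 0 ≤ c) (hs : s < T)
    (hgood : ∀ t ∈ Icc 0 s, ∀ x y, 0 ≤ coneFn ρ c δ a b t x y → u t x y ^ 2 + v t x y ^ 2 ≤ c ^ 2)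
    (hinit : ∀ x y, 0 ≤ coneFn ρ c δ a b 0 x y → h 0 x y = 0 ∧ u 0 x y = 0 ∧ v 0 x y = 0)
    {t : ℝ} (ht : t ∈ Icc 0 s) {x y : ℝ} (hq : 0 < coneFn ρ c δ a b t x y) :
    h t x y = 0 ∧ u t x y = 0 ∧ v t x y = 0 := by
  have hh : StripC1 T h := sol.contDiffOn_h
  have hu : StripC1 T u := sol.contDiffOn_u
  have hv : StripC1 T v := sol.contDiffOn_v
  have hT : ∀ t ∈ Ioc 0 s, t ∈ Ioo 0 T := fun t ht => ⟨ht.1, ht.2.trans_lt hs⟩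
  -- `h²` satisfies `D(h²) = -2 h² div(u, v)` along the flow, so the maximum principle applies;
  -- squaring handles both signs of `h` at once.
  have hvac : ∀ t ∈ Icc 0 s, ∀ x y, 0 ≤ coneFn ρ c δ a b t x y → h t x y = 0 := by
    obtain ⟨Cu, hCu⟩ := hu.exists_deriv_bound hs (isCompact_coneBase hδ ρ a b)
    obtain ⟨Cv, hCv⟩ := hv.exists_deriv_bound hs (isCompact_coneBase hδ ρ a b)
    have := cone_max_principle (C := 2 * (Cu + Cv)) hδ hc le_rfl hs (hh.pow 2) hgood
      (fun x y hq => by simp [(hinit x y hq).1]) (fun t ht x y hq => by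
        obtain ⟨h_t, h_x, h_y, u_t, u_x, u_y, v_t, v_x, v_y, ⟨Ht, Hx, Hy⟩, ⟨Ut, Ux, Uy⟩,
          ⟨Vt, Vx, Vy⟩, e₁, e₂, e₃⟩ := sol.exists_derivs (hT t ht) x y
        have hbase := mem_coneBase hc ht.1.le hq
        have b₁ := (hCu t ht x y hbase).1
        have b₂ := (hCv t ht x y hbase).2
        rw [Ux.deriv] at b₁
        rw [Vy.deriv] at b₂
        rw [(Ht.fun_pow 2).deriv, (Hx.fun_pow 2).deriv, (Hy.fun_pow 2).deriv]
        have hb : -(u_x + v_y) ≤ Cu + Cv := by linarith [(abs_le.1 b₁).1, (abs_le.1 b₂).1]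
        have := mul_le_mul_of_nonneg_left hb (sq_nonneg (h t x y))
        have e₁' : h_t = -((h_x * u t x y + h t x y * u_x) + (h_y * v t x y + h t x y * v_y)) := by
          linarith
        rw [e₁']
        norm_num
        nlinarith)
    exact fun t ht x y hq => pow_eq_zero_iff two_ne_zero |>.1
      (le_antisymm (this t ht x y hq) (sq_nonneg _))
  have hcone := (contDiff_coneFn hδ ρ c a b).continuous
  -- The level `η` is the cone function's positive value at the target point. On this smaller cone
  -- `h` vanishes in a neighbourhood of each point, so its gradient is zero, and the Coriolis force
  -- does not change `u² + v²`.
  have hspeed := cone_max_principle (C := 0) hδ hc hq.le hs ((hu.pow 2).add (hv.pow 2))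
    (fun t ht x' y' hq' => hgood t ht x' y' (hq.le.trans hq'))
    (fun x' y' hq' => by
      obtain ⟨-, h2, h3⟩ := hinit x' y' (hq.le.trans hq')
      simp [h2, h3])
    (fun t ht x' y' hq' => by
      obtain ⟨h_t, h_x, h_y, u_t, u_x, u_y, v_t, v_x, v_y, ⟨Ht, Hx, Hy⟩, ⟨Ut, Ux, Uy⟩,
        ⟨Vt, Vx, Vy⟩, e₁, e₂, e₃⟩ := sol.exists_derivs (hT t ht) x' y'
      have hpos := hq.trans_le hq'
      have hx0 : h_x = 0 := by
        refine Hx.unique ((hasDerivAt_const x' (0 : ℝ)).congr_of_eventuallyEq ?_)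
        have : ContinuousAt (fun ξ => coneFn ρ c δ a b t ξ y') x' :=
          (hcone.comp (by fun_prop : Continuous fun ξ : ℝ => (t, ξ, y'))).continuousAt
        filter_upwards [this.eventually_const_lt hpos] with ξ hξ
        exact hvac t ⟨ht.1.le, ht.2⟩ ξ y' hξ.le
      have hy0 : h_y = 0 := by
        refine Hy.unique ((hasDerivAt_const y' (0 : ℝ)).congr_of_eventuallyEq ?_)
        have : ContinuousAt (fun η => coneFn ρ c δ a b t x' η) y' :=
          (hcone.comp (by fun_prop : Continuous fun η : ℝ => (t, x', η))).continuousAt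
        filter_upwards [this.eventually_const_lt hpos] with η hη
        exact hvac t ⟨ht.1.le, ht.2⟩ x' η hη.le
      rw [((Ut.fun_pow 2).fun_add (Vt.fun_pow 2)).deriv, ((Ux.fun_pow 2).fun_add (Vx.fun_pow 2)).deriv,
        ((Uy.fun_pow 2).fun_add (Vy.fun_pow 2)).deriv]
      have e₂' : u_t = - u t x' y' * u_x - v t x' y' * u_y + v t x' y' := by linarith
      have e₃' : v_t = - u t x' y' * v_x - v t x' y' * v_y - u t x' y' := by linarith
      rw [e₂', e₃']
      norm_num
      nlinarith)
    t ht x y le_rfl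
  refine ⟨hvac t ht x y hq.le, ?_, ?_⟩
  · exact pow_eq_zero_iff two_ne_zero |>.1 (by nlinarith [sq_nonneg (u t x y), sq_nonneg (v t x y)])
  · exact pow_eq_zero_iff two_ne_zero |>.1 (by nlinarith [sq_nonneg (u t x y), sq_nonneg (v t x y)])

/-- Finite speed of propagation: a compactly supported perturbation of the state of rest of height
`hbar` spreads at speed at most `√hbar`. -/
theorem IsClassicalSolution.eq_rest_of_lt {T R hbar : ℝ} {h u v : ℝ → ℝ → ℝ → ℝ}
    (sol : IsClassicalSolution T h u v) (hR : 0 ≤ R) (hbar0 : 0 ≤ hbar)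
    (hinit : ∀ x y, R ^ 2 < x ^ 2 + y ^ 2 → h 0 x y = hbar ∧ u 0 x y = 0 ∧ v 0 x y = 0)
    {t : ℝ} (ht : t ∈ Ico 0 T) {x y : ℝ} (hxy : (R + √hbar * t) ^ 2 < x ^ 2 + y ^ 2) :
    h t x y = hbar ∧ u t x y = 0 ∧ v t x y = 0 := by
  have hs0 := Real.sqrt_nonneg hbar
  set r := √(x ^ 2 + y ^ 2) with hr
  have hr2 : r ^ 2 = x ^ 2 + y ^ 2 := Real.sq_sqrt (by positivity)
  have hr0 : 0 ≤ r := Real.sqrt_nonneg _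
  have hlt : R + √hbar * t < r := by
    rw [← hr2] at hxy
    exact lt_of_pow_lt_pow_left₀ 2 hr0 hxy
  obtain ⟨c, hc, hct⟩ : ∃ c, √hbar < c ∧ R + c * t < r := by
    -- The slack `r - R - √hbar * t` is positive, and `t / (2(t + 1)) < 1` leaves part of it unused.
    refine ⟨√hbar + (r - R - √hbar * t) / (2 * (t + 1)), ?_, ?_⟩
    · have : 0 < (r - R - √hbar * t) / (2 * (t + 1)) :=
        div_pos (by linarith) (by linarith [ht.1])
      linarith
    · have ht1 : 0 < t + 1 := by linarith [ht.1]
      have : (r - R - √hbar * t) / (2 * (t + 1)) * t < r - R - √hbar * t := by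
        rw [div_mul_eq_mul_div, div_lt_iff₀ (by positivity)]
        nlinarith [ht.1]
      linarith
  have hc0 : 0 < c := hs0.trans_lt hc
  obtain ⟨δ, hδ, hδr⟩ : ∃ δ > 0, R + c * t + δ < r :=
    ⟨(r - R - c * t) / 2, by linarith, by linarith⟩
  -- The base is centred at `(x, y)` with radius `r - R`, the distance from there to the disc `B_R`.
  have hq : 0 < coneFn (r - R) c δ x y t x y := by
    have : smoothNorm δ (x - x) (y - y) = δ := by
      simp [smoothNorm, Real.sqrt_sq hδ.le]
    unfold coneFn
    rw [this]
    linarith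
  have hq0 : ∀ x' y', 0 ≤ coneFn (r - R) c δ x y 0 x' y' →
      h 0 x' y' = hbar ∧ u 0 x' y' = 0 ∧ v 0 x' y' = 0 := by
    intro x' y' hq'
    refine hinit x' y' ?_
    unfold coneFn at hq'
    have h1 := sq_add_sq_lt_of_smoothNorm_le (ρ := r - R) hδ (by linarith)
    have hRr : 0 < r - R := by nlinarith [mul_nonneg hc0.le ht.1]
    by_contra! hn
    have h2 : x * x' + y * y' ≤ r * R := by
      refine abs_le_of_sq_le_sq' ?_ (by positivity) |>.2
      rw [mul_pow, hr2]
      nlinarith [sq_nonneg (x * y' - y * x'),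
        mul_le_mul_of_nonneg_left hn (by positivity : 0 ≤ x ^ 2 + y ^ 2)]
    -- Projection onto the direction of `(x, y)`: a point of `B_R` lies at distance at least `r - R`
    -- from `(x, y)`, contradicting `h1`.
    have h3 : (r * r - r * R) ^ 2 ≤ r ^ 2 * ((x' - x) ^ 2 + (y' - y) ^ 2) := by
      have h4 : r * r - r * R ≤ x * (x - x') + y * (y - y') := by nlinarith
      have h5 : 0 ≤ r * r - r * R := by nlinarith
      have h6 := pow_le_pow_left₀ h5 h4 2
      refine h6.trans ?_
      rw [hr2]
      nlinarith [sq_nonneg (x * (y - y') - y * (x - x'))]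
    have hrpos : 0 < r ^ 2 := by
      have : 0 < r := by linarith
      positivity
    nlinarith [mul_lt_mul_of_pos_left h1 hrpos]
  have hw : ContinuousOn (fun p : ℝ × ℝ × ℝ => (h p.1 p.2.1 p.2.2, u p.1 p.2.1 p.2.2,
      v p.1 p.2.1 p.2.2)) (Ico 0 T ×ˢ univ) :=
    sol.contDiffOn_h.continuousOn.prodMk
      (sol.contDiffOn_u.continuousOn.prodMk sol.contDiffOn_v.continuousOn)
  have hiff (t x y : ℝ) : ((h t x y, u t x y, v t x y) = (hbar, (0 : ℝ), (0 : ℝ))) ↔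
      (h t x y = hbar ∧ u t x y = 0 ∧ v t x y = 0) := by simp
  rcases hbar0.lt_or_eq with hpos | hzero
  -- Here `G` is positivity of height together with all characteristic speeds below `c`; rest
  -- belongs to it because `√hbar < c`.
  · refine (hiff t x y).1 (cone_bootstrap (G := {w | 0 < w.1 ∧ √(w.2.1 ^ 2 + w.2.2 ^ 2) + √w.1 < c})
      hδ hc0 ?_ ?_ hw (fun x' y' hq' => (hiff 0 x' y').2 (hq0 x' y' hq')) ?_ ht hq)
    · exact (isOpen_lt continuous_const continuous_fst).inter
        (isOpen_lt (by fun_prop : Continuous fun w : ℝ × ℝ × ℝ => √(w.2.1 ^ 2 + w.2.2 ^ 2) + √w.1)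
          continuous_const)
    · exact ⟨hpos, by simpa using hc⟩
    · intro s hs0 hs hgood t ht x' y' hq'
      exact (hiff t x' y').2 (sol.cone_energy hδ hc0.le hs0 hs
        (fun τ hτ ξ η hqq => ⟨(hgood τ hτ ξ η hqq).1, (hgood τ hτ ξ η hqq).2.le⟩) hq0 ht hq')
  · subst hzero
    -- In vacuum only the flow speed needs to be controlled.
    refine (hiff t x y).1 (cone_bootstrap (G := {w | w.2.1 ^ 2 + w.2.2 ^ 2 < c ^ 2})
      hδ hc0 ?_ ?_ hw (fun x' y' hq' => (hiff 0 x' y').2 (hq0 x' y' hq')) ?_ ht hq)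
    · exact isOpen_lt (by fun_prop) continuous_const
    · change (0 : ℝ) ^ 2 + 0 ^ 2 < c ^ 2
      simpa using pow_pos hc0 2
    · intro s hs0 hs hgood t ht x' y' hq'
      exact (hiff t x' y').2 (sol.cone_vacuum hδ hc0.le hs
        (fun τ hτ ξ η hqq => le_of_lt (hgood τ hτ ξ η hqq)) hq0 ht hq')

/-! ### Nonnegativity of the height -/

/-- The height stays nonnegative as long as the flow is supported in a compact set. -/
theorem IsClassicalSolution.height_nonneg {T s : ℝ} {h u v : ℝ → ℝ → ℝ → ℝ}
    (sol : IsClassicalSolution T h u v) (hs : s < T) {K : Set (ℝ × ℝ)} (hK : IsCompact K)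
    (hout : ∀ t ∈ Icc 0 s, ∀ x y, (x, y) ∉ K → 0 ≤ h t x y ∧ u t x y = 0 ∧ v t x y = 0)
    (hinit : ∀ x y, 0 ≤ h 0 x y) {t : ℝ} (ht : t ∈ Icc 0 s) (x y : ℝ) : 0 ≤ h t x y := by
  have hh : StripC1 T h := sol.contDiffOn_h
  have hu : StripC1 T u := sol.contDiffOn_u
  have hv : StripC1 T v := sol.contDiffOn_v
  by_cases hxy : (x, y) ∈ K
  swap
  · exact (hout t ht x y hxy).1
  -- The enlargement makes the region backward invariant for short times: points of `K` are interior
  -- to `K'`, and points of `K'` outside `K` have zero velocity.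
  obtain ⟨K', hK', hKK'⟩ := exists_compact_superset hK
  obtain ⟨Cu, hCu⟩ := hu.exists_deriv_bound hs hK'
  obtain ⟨Cv, hCv⟩ := hv.exists_deriv_bound hs hK'
  have hmax := transport_max_principle (a := u) (b := v) (C := Cu + Cv) hh.neg hs
    ((isCompact_Icc (a := 0) (b := s)).prod hK') (fun p hp => hp.1)
    (fun x y _ => neg_nonpos.2 (hinit x y)) ?_ ?_ t x y ⟨ht, interior_subset (hKK' hxy)⟩
  · linarith
  · rintro t x y ⟨ht, hxy⟩ ht0
    have htime : ∀ᶠ r in nhdsWithin (0 : ℝ) (Iio 0), t + r ∈ Icc 0 s := by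
      have : Ioo (-t) 0 ∈ nhdsWithin (0 : ℝ) (Iio 0) := Ioo_mem_nhdsLT (by linarith)
      filter_upwards [this] with r hr
      have ht2 : t ≤ s := ht.2
      exact ⟨by linarith [hr.1], by linarith [hr.2]⟩
    by_cases hk : (x, y) ∈ K
    · have hcont : ContinuousAt (fun r : ℝ => (x + r * u t x y, y + r * v t x y)) 0 := by fun_prop
      have hmem : interior K' ∈ nhds ((fun r : ℝ => (x + r * u t x y, y + r * v t x y)) 0) := by
        simpa using isOpen_interior.mem_nhds (hKK' hk)
      filter_upwards [htime, nhdsWithin_le_nhds (hcont hmem)] with r hr1 hr2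
      exact ⟨hr1, interior_subset hr2⟩
    · obtain ⟨-, h2, h3⟩ := hout t ht x y hk
      filter_upwards [htime] with r hr
      rw [h2, h3, mul_zero, add_zero, add_zero]
      exact ⟨hr, hxy⟩
  · rintro t x y ⟨ht, hxy⟩ ht0 hneg
    have ht' : t ∈ Ioc 0 s := ⟨ht0, ht.2⟩
    obtain ⟨h_t, h_x, h_y, u_t, u_x, u_y, v_t, v_x, v_y, ⟨Ht, Hx, Hy⟩, ⟨Ut, Ux, Uy⟩,
      ⟨Vt, Vx, Vy⟩, e₁, e₂, e₃⟩ := sol.exists_derivs ⟨ht0, ht'.2.trans_lt hs⟩ x y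
    have b₁ := (hCu t ht' x y hxy).1
    have b₂ := (hCv t ht' x y hxy).2
    rw [Ux.deriv] at b₁
    rw [Vy.deriv] at b₂
    rw [Ht.fun_neg.deriv, Hx.fun_neg.deriv, Hy.fun_neg.deriv]
    have hb : -(u_x + v_y) ≤ Cu + Cv := by linarith [(abs_le.1 b₁).1, (abs_le.1 b₂).1]
    nlinarith [mul_le_mul_of_nonneg_left hb hneg.le]

/-! ### The rotation ODE -/

theorem eq_initial_of_hasDerivAt_zero {s : ℝ} {f : ℝ → ℝ} (hc : ContinuousOn f (Ico 0 s))
    (hd : ∀ t ∈ Ioo 0 s, HasDerivAt f 0 t) {t : ℝ} (ht : t ∈ Ico 0 s) : f t = f 0 := by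
  rcases ht.1.lt_or_eq with h | h
  · obtain ⟨c, hcm, hc⟩ := exists_hasDerivAt_eq_slope f (fun _ => 0) h
      (hc.mono fun τ hτ => ⟨hτ.1, hτ.2.trans_lt ht.2⟩) fun τ hτ => hd τ ⟨hτ.1, hτ.2.trans ht.2⟩
    rw [eq_comm, div_eq_zero_iff] at hc
    rcases hc with hc | hc <;> linarith
  · rw [← h]

/-- Solutions of `P' = Q`, `Q' = -P` rotate. -/
theorem eq_rotation_of_hasDerivAt {s : ℝ} {P Q : ℝ → ℝ} (hP : ContinuousOn P (Ico 0 s))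
    (hQ : ContinuousOn Q (Ico 0 s)) (hP' : ∀ t ∈ Ioo 0 s, HasDerivAt P (Q t) t)
    (hQ' : ∀ t ∈ Ioo 0 s, HasDerivAt Q (-P t) t) {t : ℝ} (ht : t ∈ Ico 0 s) :
    P t = P 0 * Real.cos t + Q 0 * Real.sin t := by
  -- `P cos - Q sin` and `P sin + Q cos` are constants of motion.
  have h1 := eq_initial_of_hasDerivAt_zero
    ((hP.mul Real.continuous_cos.continuousOn).sub (hQ.mul Real.continuous_sin.continuousOn))
    (fun τ hτ => (((hP' τ hτ).mul (Real.hasDerivAt_cos τ)).sub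
      ((hQ' τ hτ).mul (Real.hasDerivAt_sin τ))).congr_deriv (by ring)) ht
  have h2 := eq_initial_of_hasDerivAt_zero
    ((hP.mul Real.continuous_sin.continuousOn).add (hQ.mul Real.continuous_cos.continuousOn))
    (fun τ hτ => (((hP' τ hτ).mul (Real.hasDerivAt_sin τ)).add
      ((hQ' τ hτ).mul (Real.hasDerivAt_cos τ))).congr_deriv (by ring)) ht
  simp at h1 h2
  linear_combination Real.cos t * h1 + Real.sin t * h2 - P t * Real.sin_sq_add_cos_sq t

/-- A rotation aligns any vector of the plane with the first axis within half a period. -/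
theorem exists_rotation_sq_eq (a b : ℝ) :
    ∃ t, 0 ≤ t ∧ t ≤ Real.pi ∧ (a * Real.cos t + b * Real.sin t) ^ 2 = a ^ 2 + b ^ 2 := by
  set z : ℂ := ⟨a, b⟩
  have ha : ‖z‖ * Real.cos z.arg = a := Complex.norm_mul_cos_arg z
  have hb : ‖z‖ * Real.sin z.arg = b := Complex.norm_mul_sin_arg z
  have key : (a * Real.cos z.arg + b * Real.sin z.arg) ^ 2 = a ^ 2 + b ^ 2 := by
    rw [← ha, ← hb]
    linear_combination ‖z‖ ^ 2 * (Real.sin z.arg ^ 2 + Real.cos z.arg ^ 2)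
      * Real.sin_sq_add_cos_sq z.arg
  rcases le_or_gt 0 z.arg with h | h
  · exact ⟨z.arg, h, Complex.arg_le_pi z, key⟩
  -- A negative argument is shifted by half a turn; the sign change disappears in the square.
  · refine ⟨z.arg + Real.pi, by linarith [Complex.neg_pi_lt_arg z], by linarith, ?_⟩
    rw [Real.cos_add_pi, Real.sin_add_pi, ← key]
    ring

/-! ### Evolution of mass, energy and moments -/

section Evolution

variable {T s hbar : ℝ} {h u v : ℝ → ℝ → ℝ → ℝ} {K : Set (ℝ × ℝ)}

theorem IsClassicalSolution.hasDerivAt_excessMass (sol : IsClassicalSolution T h u v) (hs : s ≤ T)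
    (hK : IsCompact K)
    (hout : ∀ t ∈ Ico 0 s, ∀ x y, (x, y) ∉ K → h t x y = hbar ∧ u t x y = 0 ∧ v t x y = 0) :
    ContinuousOn (fun t => excessMass hbar (h t)) (Ico 0 s) ∧
      ∀ t ∈ Ioo 0 s, HasDerivAt (fun t => excessMass hbar (h t)) 0 t := by
  have hh : StripC1 T h := sol.contDiffOn_h
  have hu : StripC1 T u := sol.contDiffOn_u
  have hv : StripC1 T v := sol.contDiffOn_v
  have hA := hh.sub (.const T hbar)
  have hAv : ∀ t ∈ Ico 0 s, ∀ x y, (x, y) ∉ K → h t x y - hbar = 0 := fun t ht x y hxy => by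
    rw [(hout t ht x y hxy).1, sub_self]
  refine ⟨hA.continuousOn_integral hs hK hAv, fun t ht => ?_⟩
  refine (hasDerivAt_integral_of_balance (S := fun _ _ => 0) hA (hh.mul hu) (hh.mul hv) hs hK hAv
    (fun t ht x y hxy => by simp [hout t ht x y hxy])
    (fun t ht x y hxy => by simp [hout t ht x y hxy]) ht fun x y => ?_).congr_deriv (by simp)
  obtain ⟨h_t, h_x, h_y, u_t, u_x, u_y, v_t, v_x, v_y, ⟨Ht, Hx, Hy⟩, ⟨Ut, Ux, Uy⟩, ⟨Vt, Vx, Vy⟩,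
    e₁, e₂, e₃⟩ := sol.exists_derivs ⟨ht.1, ht.2.trans_le hs⟩ x y
  exact ⟨_, _, _, Ht.sub_const hbar, Hx.fun_mul Ux, Hy.fun_mul Vy, by linear_combination e₁⟩

/-- The Coriolis force does no work. The multipliers of the equations are the partial derivatives of
the energy density in `h`, `u`, `v`. -/
theorem IsClassicalSolution.hasDerivAt_energy (sol : IsClassicalSolution T h u v) (hs : s ≤ T)
    (hK : IsCompact K)
    (hout : ∀ t ∈ Ico 0 s, ∀ x y, (x, y) ∉ K → h t x y = hbar ∧ u t x y = 0 ∧ v t x y = 0) :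
    ContinuousOn (fun t => energy hbar (h t) (u t) (v t)) (Ico 0 s) ∧
      ∀ t ∈ Ioo 0 s, HasDerivAt (fun t => energy hbar (h t) (u t) (v t)) 0 t := by
  have hh : StripC1 T h := sol.contDiffOn_h
  have hu : StripC1 T u := sol.contDiffOn_u
  have hv : StripC1 T v := sol.contDiffOn_v
  have hU := hh.mul ((hu.pow 2).add (hv.pow 2))
  have hA := (hU.add (hh.pow 2)).sub (.const T (hbar ^ 2))
  have hf := hU.add ((hh.pow 2).mul (.const T 2))
  have hAv : ∀ t ∈ Ico 0 s, ∀ x y, (x, y) ∉ K →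
      h t x y * (u t x y ^ 2 + v t x y ^ 2) + h t x y ^ 2 - hbar ^ 2 = 0 := fun t ht x y hxy => by
    simp [hout t ht x y hxy]
  refine ⟨hA.continuousOn_integral hs hK hAv, fun t ht => ?_⟩
  refine (hasDerivAt_integral_of_balance (S := fun _ _ => 0) hA (hu.mul hf) (hv.mul hf) hs hK hAv
    (fun t ht x y hxy => by simp [hout t ht x y hxy])
    (fun t ht x y hxy => by simp [hout t ht x y hxy]) ht fun x y => ?_).congr_deriv (by simp)
  obtain ⟨h_t, h_x, h_y, u_t, u_x, u_y, v_t, v_x, v_y, ⟨Ht, Hx, Hy⟩, ⟨Ut, Ux, Uy⟩, ⟨Vt, Vx, Vy⟩,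
    e₁, e₂, e₃⟩ := sol.exists_derivs ⟨ht.1, ht.2.trans_le hs⟩ x y
  refine ⟨_, _, _,
    ((Ht.fun_mul ((Ut.fun_pow 2).fun_add (Vt.fun_pow 2))).fun_add (Ht.fun_pow 2)).sub_const _,
    Ux.fun_mul ((Hx.fun_mul ((Ux.fun_pow 2).fun_add (Vx.fun_pow 2))).fun_add
      ((Hx.fun_pow 2).mul_const 2)),
    Vy.fun_mul ((Hy.fun_mul ((Uy.fun_pow 2).fun_add (Vy.fun_pow 2))).fun_add
      ((Hy.fun_pow 2).mul_const 2)), ?_⟩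
  push_cast
  linear_combination (u t x y ^ 2 + v t x y ^ 2 + 2 * h t x y) * e₁ + 2 * h t x y * u t x y * e₂
    + 2 * h t x y * v t x y * e₃

/-- Virial identity: the momentum balance is tested against `(x, y)`. The trace of the stress `h u⊗u
+ (h² - hbar²)/2 · I` is the energy density, and the Coriolis term gives the angular moment.
Subtracting `hbar²` from the pressure makes the fluxes compactly supported. -/
theorem IsClassicalSolution.hasDerivAt_radialMoment (sol : IsClassicalSolution T h u v)
    (hs : s ≤ T) (hK : IsCompact K)
    (hout : ∀ t ∈ Ico 0 s, ∀ x y, (x, y) ∉ K → h t x y = hbar ∧ u t x y = 0 ∧ v t x y = 0) :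
    ContinuousOn (fun t => radialMoment (h t) (u t) (v t)) (Ico 0 s) ∧
      ∀ t ∈ Ioo 0 s, HasDerivAt (fun t => radialMoment (h t) (u t) (v t))
        (energy hbar (h t) (u t) (v t) + angularMoment (h t) (u t) (v t)) t := by
  have hh : StripC1 T h := sol.contDiffOn_h
  have hu : StripC1 T u := sol.contDiffOn_u
  have hv : StripC1 T v := sol.contDiffOn_v
  have hX := StripC1.coord_x T
  have hY := StripC1.coord_y T
  have hA := ((hh.mul hu).mul hX).add ((hh.mul hv).mul hY)
  have hp := ((hh.pow 2).sub (.const T (hbar ^ 2))).mul (.const T 2⁻¹)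
  have hE := ((hh.mul ((hu.pow 2).add (hv.pow 2))).add (hh.pow 2)).sub (.const T (hbar ^ 2))
  have hB := ((hh.mul hv).mul hX).sub ((hh.mul hu).mul hY)
  have hAv : ∀ t ∈ Ico 0 s, ∀ x y, (x, y) ∉ K →
      h t x y * u t x y * x + h t x y * v t x y * y = 0 := fun t ht x y hxy => by
    simp [hout t ht x y hxy]
  refine ⟨hA.continuousOn_integral hs hK hAv, fun t ht => ?_⟩
  have htT : t ∈ Ico 0 T := ⟨ht.1.le, ht.2.trans_le hs⟩
  have hEi : Integrable (fun p : ℝ × ℝ =>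
      h t p.1 p.2 * (u t p.1 p.2 ^ 2 + v t p.1 p.2 ^ 2) + h t p.1 p.2 ^ 2 - hbar ^ 2) :=
    (hE.contDiff_slice htT).continuous.integrable_of_hasCompactSupport
      (HasCompactSupport.intro hK fun p hp => by
        simp [hout t ⟨ht.1.le, ht.2⟩ p.1 p.2 hp])
  have hBi : Integrable (fun p : ℝ × ℝ =>
      h t p.1 p.2 * v t p.1 p.2 * p.1 - h t p.1 p.2 * u t p.1 p.2 * p.2) :=
    (hB.contDiff_slice htT).continuous.integrable_of_hasCompactSupport
      (HasCompactSupport.intro hK fun p hp => by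
        simp [hout t ⟨ht.1.le, ht.2⟩ p.1 p.2 hp])
  refine (hasDerivAt_integral_of_balance (S := fun x y =>
      (h t x y * (u t x y ^ 2 + v t x y ^ 2) + h t x y ^ 2 - hbar ^ 2)
        + (h t x y * v t x y * x - h t x y * u t x y * y)) hA
    ((hX.mul ((hh.mul (hu.pow 2)).add hp)).add (hY.mul ((hh.mul hu).mul hv)))
    ((hX.mul ((hh.mul hu).mul hv)).add (hY.mul ((hh.mul (hv.pow 2)).add hp))) hs hK hAv
    (fun t ht x y hxy => by simp [hout t ht x y hxy])
    (fun t ht x y hxy => by simp [hout t ht x y hxy]) ht fun x y => ?_).congr_deriv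
    (integral_add hEi hBi)
  obtain ⟨h_t, h_x, h_y, u_t, u_x, u_y, v_t, v_x, v_y, ⟨Ht, Hx, Hy⟩, ⟨Ut, Ux, Uy⟩, ⟨Vt, Vx, Vy⟩,
    e₁, e₂, e₃⟩ := sol.exists_derivs ⟨ht.1, ht.2.trans_le hs⟩ x y
  refine ⟨_, _, _,
    ((Ht.fun_mul Ut).mul_const x).fun_add ((Ht.fun_mul Vt).mul_const y),
    ((hasDerivAt_id' x).fun_mul ((Hx.fun_mul (Ux.fun_pow 2)).fun_add
      (((Hx.fun_pow 2).sub_const _).mul_const _))).fun_add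
      (((Hx.fun_mul Ux).fun_mul Vx).const_mul y),
    (((Hy.fun_mul Uy).fun_mul Vy).const_mul x).fun_add
      ((hasDerivAt_id' y).fun_mul ((Hy.fun_mul (Vy.fun_pow 2)).fun_add
      (((Hy.fun_pow 2).sub_const _).mul_const _))), ?_⟩
  push_cast
  linear_combination (x * u t x y + y * v t x y) * e₁ + h t x y * x * e₂ + h t x y * y * e₃

/-- The stress is symmetric and so exerts no net torque; only the Coriolis term remains. -/
theorem IsClassicalSolution.hasDerivAt_angularMoment (sol : IsClassicalSolution T h u v)
    (hs : s ≤ T) (hK : IsCompact K)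
    (hout : ∀ t ∈ Ico 0 s, ∀ x y, (x, y) ∉ K → h t x y = hbar ∧ u t x y = 0 ∧ v t x y = 0) :
    ContinuousOn (fun t => angularMoment (h t) (u t) (v t)) (Ico 0 s) ∧
      ∀ t ∈ Ioo 0 s, HasDerivAt (fun t => angularMoment (h t) (u t) (v t))
        (-radialMoment (h t) (u t) (v t)) t := by
  have hh : StripC1 T h := sol.contDiffOn_h
  have hu : StripC1 T u := sol.contDiffOn_u
  have hv : StripC1 T v := sol.contDiffOn_v
  have hX := StripC1.coord_x T
  have hY := StripC1.coord_y T
  have hp := ((hh.pow 2).sub (.const T (hbar ^ 2))).mul (.const T 2⁻¹)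
  have hA := ((hh.mul hv).mul hX).sub ((hh.mul hu).mul hY)
  have hAv : ∀ t ∈ Ico 0 s, ∀ x y, (x, y) ∉ K →
      h t x y * v t x y * x - h t x y * u t x y * y = 0 := fun t ht x y hxy => by
    simp [hout t ht x y hxy]
  refine ⟨hA.continuousOn_integral hs hK hAv, fun t ht => ?_⟩
  refine (hasDerivAt_integral_of_balance (S := fun x y =>
      -(h t x y * u t x y * x + h t x y * v t x y * y)) hA
    ((hX.mul ((hh.mul hu).mul hv)).sub (hY.mul ((hh.mul (hu.pow 2)).add hp)))
    ((hX.mul ((hh.mul (hv.pow 2)).add hp)).sub (hY.mul ((hh.mul hu).mul hv))) hs hK hAv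
    (fun t ht x y hxy => by simp [hout t ht x y hxy])
    (fun t ht x y hxy => by simp [hout t ht x y hxy]) ht fun x y => ?_).congr_deriv
    (integral_neg _)
  obtain ⟨h_t, h_x, h_y, u_t, u_x, u_y, v_t, v_x, v_y, ⟨Ht, Hx, Hy⟩, ⟨Ut, Ux, Uy⟩, ⟨Vt, Vx, Vy⟩,
    e₁, e₂, e₃⟩ := sol.exists_derivs ⟨ht.1, ht.2.trans_le hs⟩ x y
  refine ⟨_, _, _,
    ((Ht.fun_mul Vt).mul_const x).fun_sub ((Ht.fun_mul Ut).mul_const y),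
    ((hasDerivAt_id' x).fun_mul ((Hx.fun_mul Ux).fun_mul Vx)).fun_sub
      (((Hx.fun_mul (Ux.fun_pow 2)).fun_add
        (((Hx.fun_pow 2).sub_const _).mul_const _)).const_mul y),
    (((Hy.fun_mul (Vy.fun_pow 2)).fun_add
        (((Hy.fun_pow 2).sub_const _).mul_const _)).const_mul x).fun_sub
      ((hasDerivAt_id' y).fun_mul ((Hy.fun_mul Uy).fun_mul Vy)), ?_⟩
  push_cast
  linear_combination (x * v t x y - y * u t x y) * e₁ - h t x y * y * e₂ + h t x y * x * e₃

end Evolution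

/-! ### Estimates at a fixed time -/

theorem isClosed_disc (r : ℝ) : IsClosed (disc r) :=
  isClosed_le (by fun_prop : Continuous fun p : ℝ × ℝ => p.1 ^ 2 + p.2 ^ 2) continuous_const

theorem isCompact_disc {r : ℝ} (hr : 0 ≤ r) : IsCompact (disc r) := by
  refine (isCompact_Icc (a := -r) (b := r)).prod (isCompact_Icc (a := -r) (b := r))
    |>.of_isClosed_subset (isClosed_disc r) fun p hp => ?_
  have hp' : p.1 ^ 2 + p.2 ^ 2 ≤ r ^ 2 := hp
  exact ⟨abs_le_of_sq_le_sq' (by nlinarith [sq_nonneg p.2]) hr,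
    abs_le_of_sq_le_sq' (by nlinarith [sq_nonneg p.1]) hr⟩

theorem volume_real_disc {r : ℝ} (hr : 0 ≤ r) : volume.real (disc r) = Real.pi * r ^ 2 := by
  have h1 : Complex.measurableEquivRealProd ⁻¹' disc r = Metric.closedBall 0 r := by
    ext z
    have : z ∈ Complex.measurableEquivRealProd ⁻¹' disc r ↔ z.re ^ 2 + z.im ^ 2 ≤ r ^ 2 := Iff.rfl
    rw [this, mem_closedBall_zero_iff, ← sq_le_sq₀ (norm_nonneg z) hr, Complex.sq_norm,
      Complex.normSq_apply, sq, sq, sq]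
  have h2 := Complex.volume_preserving_equiv_real_prod.measure_preimage
    (isClosed_disc r).measurableSet.nullMeasurableSet
  rw [h1, Complex.volume_closedBall] at h2
  rw [measureReal_def, ← h2]
  simp [hr, mul_comm]

section Slice

variable {hbar r : ℝ} {h u v : ℝ → ℝ → ℝ}

theorem setIntegral_height_eq (hr : 0 ≤ r) (hh : Continuous fun p : ℝ × ℝ => h p.1 p.2)
    (hout : ∀ x y, (x, y) ∉ disc r → h x y = hbar) :
    ∫ p in disc r, h p.1 p.2 = excessMass hbar h + hbar * (Real.pi * r ^ 2) := by
  have hK := isCompact_disc hr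
  have h1 : excessMass hbar h = ∫ p in disc r, (h p.1 p.2 - hbar) :=
    (setIntegral_eq_integral_of_forall_compl_eq_zero fun p hp => by
      rw [hout p.1 p.2 hp, sub_self]).symm
  rw [h1, integral_sub (hh.continuousOn.integrableOn_compact hK)
    (integrableOn_const hK.measure_ne_top), setIntegral_const, volume_real_disc hr, smul_eq_mul]
  ring

theorem setIntegral_height_le (hr : 0 ≤ r) (hh : Continuous fun p : ℝ × ℝ => h p.1 p.2)
    (hout : ∀ x y, (x, y) ∉ disc r → h x y = hbar) :
    ∫ p in disc r, h p.1 p.2 ≤ supNorm h * (Real.pi * r ^ 2) := by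
  have hK := isCompact_disc hr
  obtain ⟨C, hC⟩ := hK.exists_bound_of_continuousOn hh.continuousOn
  have hbdd : ∀ p : ℝ × ℝ, ‖h p.1 p.2‖ ≤ max C |hbar| := fun p => by
    by_cases hp : p ∈ disc r
    · exact (hC p hp).trans (le_max_left _ _)
    · rw [hout p.1 p.2 hp]
      exact le_max_right _ _
  have hmem : MemLp (fun p : ℝ × ℝ => h p.1 p.2) ⊤ volume :=
    memLp_top_of_bound hh.aestronglyMeasurable _ (Filter.Eventually.of_forall hbdd)
  have hae : ∀ᵐ p : ℝ × ℝ, h p.1 p.2 ≤ supNorm h := by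
    filter_upwards [ae_le_eLpNormEssSup (f := fun p : ℝ × ℝ => h p.1 p.2) (μ := volume)] with p hp
    refine (le_abs_self _).trans ?_
    have h2 := ENNReal.toReal_mono hmem.2.ne (hp.trans_eq eLpNorm_exponent_top.symm)
    simpa [supNorm] using h2
  have := setIntegral_mono_ae (hh.continuousOn.integrableOn_compact hK)
    (integrableOn_const (C := supNorm h) hK.measure_ne_top) hae
  rwa [setIntegral_const, volume_real_disc hr, smul_eq_mul, mul_comm] at this

/-- Weighted Cauchy–Schwarz with weight `h ≥ 0`, using `x² + y² ≤ r²` on the disc. -/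
theorem radialMoment_sq_le (hr : 0 ≤ r) (hh : Continuous fun p : ℝ × ℝ => h p.1 p.2)
    (hu : Continuous fun p : ℝ × ℝ => u p.1 p.2) (hv : Continuous fun p : ℝ × ℝ => v p.1 p.2)
    (hh0 : ∀ x y, 0 ≤ h x y) (hout : ∀ x y, (x, y) ∉ disc r → u x y = 0 ∧ v x y = 0) :
    radialMoment h u v ^ 2 ≤
      (∫ p : ℝ × ℝ, h p.1 p.2 * (u p.1 p.2 ^ 2 + v p.1 p.2 ^ 2))
        * (r ^ 2 * ∫ p in disc r, h p.1 p.2) := by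
  have hK := isCompact_disc hr
  have hi {f : ℝ × ℝ → ℝ} (hf : Continuous f) : IntegrableOn f (disc r) :=
    hf.continuousOn.integrableOn_compact hK
  have hP : radialMoment h u v
      = ∫ p in disc r, (h p.1 p.2 * u p.1 p.2 * p.1 + h p.1 p.2 * v p.1 p.2 * p.2) :=
    (setIntegral_eq_integral_of_forall_compl_eq_zero fun p hp => by
      simp [hout p.1 p.2 hp]).symm
  have hE : ∫ p : ℝ × ℝ, h p.1 p.2 * (u p.1 p.2 ^ 2 + v p.1 p.2 ^ 2)
      = ∫ p in disc r, h p.1 p.2 * (u p.1 p.2 ^ 2 + v p.1 p.2 ^ 2) :=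
    (setIntegral_eq_integral_of_forall_compl_eq_zero fun p hp => by
      simp [hout p.1 p.2 hp]).symm
  rw [hP, hE]
  set P := ∫ p in disc r, (h p.1 p.2 * u p.1 p.2 * p.1 + h p.1 p.2 * v p.1 p.2 * p.2)
  set E := ∫ p in disc r, h p.1 p.2 * (u p.1 p.2 ^ 2 + v p.1 p.2 ^ 2) with hEdef
  -- The quadratic is the integral of `h (|z(u, v) + (x, y)|² + r² - x² - y²)`; nonpositivity of its
  -- discriminant is the claim.
  have hquad : ∀ z : ℝ, 0 ≤ E * (z * z) + 2 * P * z + r ^ 2 * ∫ p in disc r, h p.1 p.2 := by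
    intro z
    have h1 : E * (z * z) + 2 * P * z + r ^ 2 * ∫ p in disc r, h p.1 p.2 =
        ∫ p in disc r, (h p.1 p.2 * (u p.1 p.2 ^ 2 + v p.1 p.2 ^ 2) * (z * z)
          + (h p.1 p.2 * u p.1 p.2 * p.1 + h p.1 p.2 * v p.1 p.2 * p.2) * (2 * z)
          + h p.1 p.2 * r ^ 2) := by
      rw [integral_add (hi (by fun_prop)) (hi (by fun_prop)),
        integral_add (hi (by fun_prop)) (hi (by fun_prop)), integral_mul_const, integral_mul_const,
        integral_mul_const]
      ring
    rw [h1]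
    refine setIntegral_nonneg hK.measurableSet fun p hp => ?_
    have hp' : p.1 ^ 2 + p.2 ^ 2 ≤ r ^ 2 := hp
    have h2 : 0 ≤ (z * u p.1 p.2 + p.1) ^ 2 + (z * v p.1 p.2 + p.2) ^ 2
        + (r ^ 2 - (p.1 ^ 2 + p.2 ^ 2)) := by
      have : 0 ≤ r ^ 2 - (p.1 ^ 2 + p.2 ^ 2) := by linarith
      positivity
    have h3 := mul_nonneg (hh0 p.1 p.2) h2
    linarith
  have := discrim_le_zero hquad
  unfold discrim at this
  linarith

/-- The difference is the integral of `(h - hbar)²` plus `2 hbar` times the excess mass. The first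
term is strictly positive, since otherwise `h = hbar` and the excess mass would vanish. -/
theorem kineticEnergy_lt_energy (hbar0 : 0 ≤ hbar) (hr : 0 ≤ r)
    (hh : Continuous fun p : ℝ × ℝ => h p.1 p.2) (hu : Continuous fun p : ℝ × ℝ => u p.1 p.2)
    (hv : Continuous fun p : ℝ × ℝ => v p.1 p.2)
    (hout : ∀ x y, (x, y) ∉ disc r → h x y = hbar ∧ u x y = 0 ∧ v x y = 0)
    (hm : 0 < excessMass hbar h) :
    ∫ p : ℝ × ℝ, h p.1 p.2 * (u p.1 p.2 ^ 2 + v p.1 p.2 ^ 2) < energy hbar h u v := by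
  have hK := isCompact_disc hr
  have hi {f : ℝ × ℝ → ℝ} (hf : Continuous f) (hf0 : ∀ p, p ∉ disc r → f p = 0) : Integrable f :=
    hf.integrable_of_hasCompactSupport (HasCompactSupport.intro hK hf0)
  have hk : Integrable fun p : ℝ × ℝ => h p.1 p.2 - hbar :=
    hi (by fun_prop) fun p hp => by simp [hout p.1 p.2 hp]
  have hk2 : Integrable fun p : ℝ × ℝ => (h p.1 p.2 - hbar) ^ 2 :=
    hi (by fun_prop) fun p hp => by simp [hout p.1 p.2 hp]
  have hkin : Integrable fun p : ℝ × ℝ => h p.1 p.2 * (u p.1 p.2 ^ 2 + v p.1 p.2 ^ 2) :=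
    hi (by fun_prop) fun p hp => by simp [hout p.1 p.2 hp]
  have hpos : 0 < ∫ p : ℝ × ℝ, (h p.1 p.2 - hbar) ^ 2 := by
    by_contra! hn
    have hz := eq_zero_of_integral_nonpos (f := fun p : ℝ × ℝ => (h p.1 p.2 - hbar) ^ 2)
      (by fun_prop) hK (fun p hp => by simp [hout p.1 p.2 hp]) (fun p => sq_nonneg _) hn
    refine hm.ne' (integral_eq_zero_of_ae (Filter.Eventually.of_forall fun p => ?_))
    exact pow_eq_zero_iff two_ne_zero |>.1 (hz p)
  have hsplit : energy hbar h u v = (∫ p : ℝ × ℝ, h p.1 p.2 * (u p.1 p.2 ^ 2 + v p.1 p.2 ^ 2))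
      + ((∫ p : ℝ × ℝ, (h p.1 p.2 - hbar) ^ 2) + 2 * hbar * excessMass hbar h) := by
    unfold excessMass energy
    have hsum : Integrable fun p : ℝ × ℝ =>
        (h p.1 p.2 - hbar) ^ 2 + 2 * hbar * (h p.1 p.2 - hbar) := hk2.add (hk.const_mul _)
    rw [← integral_const_mul, ← integral_add hk2 (hk.const_mul _), ← integral_add hkin hsum]
    congr 1
    funext p
    ring
  rw [hsplit]
  have := mul_nonneg (mul_nonneg zero_le_two hbar0) hm.le
  linarith

end Slice

end RotatingShallowWater

/-! ### The contradiction at the alignment time -/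

theorem theorem1p1 (hbar R : ℝ) (hR : 0 ≤ R) (h₀ u₀ v₀ : ℝ → ℝ → ℝ)
    (h₀_nonneg : ∀ x y, 0 ≤ h₀ x y)
    (hsupp : tsupport (fun p : ℝ × ℝ => (h₀ p.1 p.2 - hbar, u₀ p.1 p.2, v₀ p.1 p.2))
      ⊆ RotatingShallowWater.disc R)
    (hmass : 0 < RotatingShallowWater.excessMass hbar h₀)
    (hmoment :
      Real.pi * (R + 2 * Real.pi * Real.sqrt hbar) ^ 4
          * RotatingShallowWater.energy hbar h₀ u₀ v₀ * RotatingShallowWater.supNorm h₀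
        ≤ RotatingShallowWater.radialMoment h₀ u₀ v₀ ^ 2
          + (RotatingShallowWater.energy hbar h₀ u₀ v₀
              + RotatingShallowWater.angularMoment h₀ u₀ v₀) ^ 2) :
    ∃ Tmax : ℝ, Tmax < 2 * Real.pi ∧
      ∀ (T : ℝ) (h u v : ℝ → ℝ → ℝ → ℝ), 0 < T →
        RotatingShallowWater.IsClassicalSolution T h u v →
        h 0 = h₀ → u 0 = u₀ → v 0 = v₀ → T ≤ Tmax := by
  open RotatingShallowWater in
  obtain ⟨t, ht0, htpi, ht⟩ := exists_rotation_sq_eq (radialMoment h₀ u₀ v₀)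
    (energy hbar h₀ u₀ v₀ + angularMoment h₀ u₀ v₀)
  refine ⟨t, by linarith [Real.pi_pos], ?_⟩
  rintro T h u v - sol rfl rfl rfl
  by_contra! htT
  have hrest : ∀ x y, R ^ 2 < x ^ 2 + y ^ 2 → h 0 x y = hbar ∧ u 0 x y = 0 ∧ v 0 x y = 0 := by
    intro x y hxy
    have : (x, y) ∉ disc R := fun hmem => hxy.not_ge hmem
    have := image_eq_zero_of_notMem_tsupport fun hmem => this (hsupp hmem)
    simpa [sub_eq_zero] using this
  have hbar0 : 0 ≤ hbar := by
    rw [← (hrest (R + 1) 0 (by nlinarith)).1]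
    exact h₀_nonneg _ _
  set r := R + 2 * Real.pi * √hbar with hr
  have hsq := Real.sqrt_nonneg hbar
  have hr0 : 0 ≤ r := by positivity
  -- Capping at `2π` keeps the perturbation inside the fixed disc of radius `r`.
  set s := min T (2 * Real.pi) with hs
  have hsT : s ≤ T := min_le_left _ _
  have hts : t ∈ Ico 0 s := ⟨ht0, lt_min htT (by linarith [Real.pi_pos])⟩
  have h0s : (0 : ℝ) ∈ Ico 0 s := ⟨le_rfl, ht0.trans_lt hts.2⟩
  have hout : ∀ τ ∈ Ico 0 s, ∀ x y, (x, y) ∉ disc r →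
      h τ x y = hbar ∧ u τ x y = 0 ∧ v τ x y = 0 := by
    intro τ hτ x y hxy
    refine sol.eq_rest_of_lt hR hbar0 hrest ⟨hτ.1, hτ.2.trans_le hsT⟩ ?_
    have h1 : r ^ 2 < x ^ 2 + y ^ 2 := lt_of_not_ge hxy
    refine lt_of_le_of_lt (pow_le_pow_left₀ (add_nonneg hR (mul_nonneg hsq hτ.1)) ?_ 2) h1
    have h2 : τ ≤ 2 * Real.pi := hτ.2.le.trans (min_le_right _ _)
    nlinarith [mul_le_mul_of_nonneg_left h2 hsq]
  have hK := isCompact_disc hr0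
  obtain ⟨mc, md⟩ := sol.hasDerivAt_excessMass hsT hK hout
  obtain ⟨ec, ed⟩ := sol.hasDerivAt_energy hsT hK hout
  obtain ⟨Pc, Pd⟩ := sol.hasDerivAt_radialMoment hsT hK hout
  obtain ⟨Qc, Qd⟩ := sol.hasDerivAt_angularMoment hsT hK hout
  have hm := eq_initial_of_hasDerivAt_zero mc md hts
  have hE := eq_initial_of_hasDerivAt_zero ec ed hts
  have hP := eq_rotation_of_hasDerivAt Pc (ec.add Qc) Pd
    (fun τ hτ => ((ed τ hτ).add (Qd τ hτ)).congr_deriv (zero_add _)) hts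
  have hct : t ∈ Ico 0 T := ⟨ht0, htT⟩
  have hc0 : (0 : ℝ) ∈ Ico 0 T := ⟨le_rfl, ht0.trans_lt htT⟩
  have hh : StripC1 T h := sol.contDiffOn_h
  have hu : StripC1 T u := sol.contDiffOn_u
  have hv : StripC1 T v := sol.contDiffOn_v
  have hhc := (hh.contDiff_slice hct).continuous
  have huc := (hu.contDiff_slice hct).continuous
  have hvc := (hv.contDiff_slice hct).continuous
  have hnonneg : ∀ x y, 0 ≤ h t x y := fun x y =>
    sol.height_nonneg htT hK (fun τ hτ x y hxy => by
      obtain ⟨h1, h2⟩ := hout τ ⟨hτ.1, hτ.2.trans_lt hts.2⟩ x y hxy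
      exact ⟨h1 ▸ hbar0, h2⟩) h₀_nonneg ⟨ht0, le_rfl⟩ x y
  have hM := setIntegral_height_eq hr0 hhc fun x y hxy => (hout t hts x y hxy).1
  have hM0 := setIntegral_height_eq hr0 (hh.contDiff_slice hc0).continuous
    fun x y hxy => (hout 0 h0s x y hxy).1
  have hle := setIntegral_height_le hr0 (hh.contDiff_slice hc0).continuous
    fun x y hxy => (hout 0 h0s x y hxy).1
  have hCS := radialMoment_sq_le hr0 hhc huc hvc hnonneg fun x y hxy => (hout t hts x y hxy).2
  have hlt := kineticEnergy_lt_energy hbar0 hr0 hhc huc hvc (hout t hts) (by rw [hm]; exact hmass)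
  rw [hm, ← hM0] at hM
  rw [hM] at hCS
  set K := ∫ p : ℝ × ℝ, h t p.1 p.2 * (u t p.1 p.2 ^ 2 + v t p.1 p.2 ^ 2) with hKdef
  set E := energy hbar (h 0) (u 0) (v 0)
  have hK0 : 0 ≤ K := integral_nonneg fun p =>
    mul_nonneg (hnonneg _ _) (add_nonneg (sq_nonneg _) (sq_nonneg _))
  rw [hE] at hlt
  -- Positivity of the initial mass in the disc, needed to keep `K < E` strict after multiplication.
  have hbig : 0 < supNorm (h 0) * (Real.pi * r ^ 2) := by
    refine lt_of_lt_of_le ?_ hle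
    rw [hM0]
    have := Real.pi_pos
    positivity
  have hrpos : 0 < r ^ 2 := by
    refine (sq_nonneg r).lt_of_ne fun h0 => ?_
    rw [← h0] at hbig
    simp at hbig
  have h1 : K * (r ^ 2 * ∫ p in disc r, h 0 p.1 p.2)
      ≤ K * (r ^ 2 * (supNorm (h 0) * (Real.pi * r ^ 2))) := by gcongr
  have h2 : K * (r ^ 2 * (supNorm (h 0) * (Real.pi * r ^ 2)))
      < E * (r ^ 2 * (supNorm (h 0) * (Real.pi * r ^ 2))) := by gcongr
  rw [hP] at hCS
  simp only [Pi.add_apply] at hCS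
  rw [ht] at hCS
  have h3 : E * (r ^ 2 * (supNorm (h 0) * (Real.pi * r ^ 2)))
      = Real.pi * r ^ 4 * E * supNorm (h 0) := by ring
  linarith
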